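/- Let $l_x,l_y>0$, let $\Omega=\mathbb{T}^2_{xy}\times[0,1]_z$, where $\mathbb{T}^2_{xy}$ is the flat torus with periods $l_x,l_y$ (so $|\Omega|=l_xl_y$), and let $Pe\in\mathbb{R}$. Let $H^1_0(\Omega)$ be the closure of $C_c^\infty(\mathbb{T}^2_{xy}\times(0,1))$ in $H^1(\Omega)$, and let $\Delta^{-1}$ be the inverse Laplacian with vanishing Dirichlet conditions at $z=0,1$, with values in $H^1_0(\Omega)$. Let $V$ be the set of divergence-free $\mathbf{u}\in H^1_0(\Omega;\mathbb{R}^3)$, and write $w$ for the vertical component of $\mathbf{u}$. For $\tau\in H^1(0,1)$ with $\tau(0)=1$, $\tau(1)=0$, and for $\lambda\in\mathbb{R}$, $\mathbf{u}\in V$, $\theta\in H^1_0(\Omega)$, let \[ H_{\tau,\lambda}(\mathbf{u},\theta)=\frac{1}{|\Omega|}\int_\Omega\Big( \frac{\lambda}{2}|\nabla\mathbf{u}|^2+\frac12|\nabla\theta|^2+w\,\theta\,\tau'(z)\Big), \] and write $H_{\tau,\lambda}\ge 0$ if $H_{\tau,\lambda}(\mathbf{u},\theta)\ge0$ for all $\mathbf{u}\in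 V$ and $\theta\in H^1_0(\Omega)$. The optimal value of the modified background-method bound is \[ U_{\mathrm{bm}}(Pe)=\inf\Big\{\int_0^1|\tau'|^2\,dz+\lambda Pe^2:\ \tau\in H^1(0,1),\ \tau(0)=1,\ \tau(1)=0,\ \lambda\in\mathbb{R},\ H_{\tau,\lambda}\ge0\Big\}. \] Let $\mathcal{A}$ be the set of $\eta\in H^1(\Omega)\cap L^\infty(\Omega)$ with $\eta|_{z=0}=1$ and $\eta|_{z=1}=0$, that is, $\eta-(1-z)\in H^1_0(\Omega)$. The optimal value of the symmetrization-method bound is \[ U_{\mathrm{symm}}(Pe)=\inf_{\eta\in\mathcal{A}}\Big\{\frac{1}{|\Omega|}\int_\Omega|\nabla\eta|^2+Pe^2\sup_{\mathbf{u}\in V,\ \frac{1}{|\Omega|}\int_\Omega|\nabla\mathbf{u}|^2=1}\ \frac{1}{|\Omega|}\int_\Omega|\nabla\Delta^{-1}\mathrm{div}(\mathbf{u}\eta)|^2\Big\}. \] Then $U_{\mathrm{bm}}(Pe)=U_{\mathrm{symm}}(Pe)$. Moreover, the value $U_{\mathrm{symm}}(Pe)$ is unchanged if the infimum is restricted to those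 $\eta\in\mathcal{A}$ that depend on $z$ alone. -/

import Mathlib

open MeasureTheory Set Filter Topology
open scoped ContDiff ENNReal

/-- Three-dimensional Euclidean space. -/
abbrev E3 : Type := EuclideanSpace ℝ (Fin 3)

/-- The periodic strip `𝕋²_{xy} × ℝ_z` with periods `lx`, `ly`. The fluid layer is the part
`0 ≤ z ≤ 1`; it is selected by the measure `layerMeasure` below. -/
abbrev Strip (lx ly : ℝ) : Type := AddCircle lx × AddCircle ly × ℝ

/-- The interior of the fluid layer `Ω = 𝕋²_{xy} × [0,1]`. -/
def openLayer (lx ly : ℝ) : Set (Strip lx ly) := {p | p.2.2 ∈ Ioo (0 : ℝ) 1}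

section Layer

variable {lx ly : ℝ} [Fact (0 < lx)] [Fact (0 < ly)]

/-- Lebesgue measure on the fluid layer `Ω = 𝕋²_{xy} × [0,1]` (total mass `lx * ly`). -/
noncomputable def layerMeasure (lx ly : ℝ) [Fact (0 < lx)] [Fact (0 < ly)] :
    Measure (Strip lx ly) :=
  (volume : Measure (Strip lx ly)).restrict {p | p.2.2 ∈ Icc (0 : ℝ) 1}

/-- `φ ∈ C_c^∞(Ω)`: smooth (periodic in `x` and `y`), with compact support in `0 < z < 1`. -/
structure IsTestFunction (φ : Strip lx ly → ℝ) : Prop where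
  smooth : ContDiff ℝ ∞
    (fun q : ℝ × ℝ × ℝ => φ ((q.1 : AddCircle lx), (q.2.1 : AddCircle ly), q.2.2))
  compact : HasCompactSupport φ
  support : tsupport φ ⊆ openLayer lx ly

/-- The classical gradient `(∂ₓφ, ∂_yφ, ∂_zφ)`. -/
noncomputable def stripGrad (φ : Strip lx ly → ℝ) (p : Strip lx ly) : E3 :=
  !₂[deriv (fun s : ℝ => φ (p.1 + (s : AddCircle lx), p.2.1, p.2.2)) 0,
     deriv (fun s : ℝ => φ (p.1, p.2.1 + (s : AddCircle ly), p.2.2)) 0,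
     deriv (fun s : ℝ => φ (p.1, p.2.1, p.2.2 + s)) 0]

/-- `v ∈ H¹₀(Ω)` and `G = ∇v`: the pair `(v, G)` is the `L²`-limit of `(φₙ, ∇φₙ)` for some
`φₙ ∈ C_c^∞(Ω)`. The limit `G` is the weak gradient of `v`, so it is determined a.e. by `v`. -/
structure MemH10 (v : Strip lx ly → ℝ) (G : Strip lx ly → E3) : Prop where
  memLp : MemLp v 2 (layerMeasure lx ly)
  memLp_grad : MemLp G 2 (layerMeasure lx ly)
  approx : ∃ φ : ℕ → Strip lx ly → ℝ, (∀ n, IsTestFunction (φ n)) ∧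
    Tendsto (fun n => eLpNorm (fun p => φ n p - v p) 2 (layerMeasure lx ly)) atTop (𝓝 0) ∧
    Tendsto (fun n => eLpNorm (fun p => stripGrad (φ n) p - G p) 2 (layerMeasure lx ly))
      atTop (𝓝 0)

/-- `u = (u₀, u₁, u₂) ∈ H¹₀(Ω; ℝ³)` with `∇uᵢ = Du i` and `div u = 0`
(no-slip, divergence-free velocity fields; `u 2` is the vertical component `w`). -/
structure IsNoSlipFlow (u : Fin 3 → Strip lx ly → ℝ) (Du : Fin 3 → Strip lx ly → E3) : Prop where
  memH10 : ∀ i, MemH10 (u i) (Du i)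
  div_free : ∀ᵐ p ∂(layerMeasure lx ly), ∑ i, Du i p i = 0

/-- `⨍_Ω |∇u|²`. -/
noncomputable def meanEnstrophy (Du : Fin 3 → Strip lx ly → E3) : ℝ :=
  ⨍ p, ∑ i, ‖Du i p‖ ^ 2 ∂(layerMeasure lx ly)

/-- The vector field `u η`. -/
noncomputable def fluxField (u : Fin 3 → Strip lx ly → ℝ) (η : Strip lx ly → ℝ) :
    Strip lx ly → E3 :=
  fun p => WithLp.toLp 2 (fun i => u i p * η p)

/-- The distribution `div m` for `m ∈ L²(Ω; ℝ³)`, as a functional on test functions. -/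
noncomputable def divDistribution (m : Strip lx ly → E3) : (Strip lx ly → ℝ) → ℝ :=
  fun φ => -∫ p, inner ℝ (m p) (stripGrad φ p) ∂(layerMeasure lx ly)

/-- `v = Δ⁻¹ T` and `G = ∇v`, with vanishing Dirichlet conditions: `v ∈ H¹₀(Ω)` and `Δ v = T` in
the sense of distributions. -/
structure IsInverseLaplacian (T : (Strip lx ly → ℝ) → ℝ) (v : Strip lx ly → ℝ)
    (G : Strip lx ly → E3) : Prop where
  memH10 : MemH10 v G
  laplacian_eq : ∀ φ : Strip lx ly → ℝ, IsTestFunction φ →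
    -∫ p, inner ℝ (G p) (stripGrad φ p) ∂(layerMeasure lx ly) = T φ

/-- `M(η) = sup { ⨍_Ω |∇Δ⁻¹ div(u η)|² : u no-slip, div u = 0, ⨍_Ω |∇u|² = 1 }`, where
`v` stands for `Δ⁻¹ div(u η)` and `Dv` for its gradient. -/
noncomputable def transportSup (η : Strip lx ly → ℝ) : EReal :=
  sSup {r : EReal | ∃ (u : Fin 3 → Strip lx ly → ℝ) (Du : Fin 3 → Strip lx ly → E3)
    (v : Strip lx ly → ℝ) (Dv : Strip lx ly → E3),
    IsNoSlipFlow u Du ∧ meanEnstrophy Du = 1 ∧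
    IsInverseLaplacian (divDistribution (fluxField u η)) v Dv ∧
    r = ((⨍ p, ‖Dv p‖ ^ 2 ∂(layerMeasure lx ly) : ℝ) : EReal)}

/-- `η ∈ H¹(Ω) ∩ L^∞(Ω)` with `η = 1` at `z = 0`, `η = 0` at `z = 1`, and `Dη = ∇η`.
The boundary conditions say that `η - (1 - z) ∈ H¹₀(Ω)`, whose gradient is `∇η + (0, 0, 1)`. -/
structure IsSymmAdmissible (η : Strip lx ly → ℝ) (Dη : Strip lx ly → E3) : Prop where
  memH10_sub : MemH10 (fun p => η p - (1 - p.2.2)) (fun p => Dη p + !₂[(0 : ℝ), 0, 1])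
  bounded : MemLp η ∞ (layerMeasure lx ly)

/-- The infimum of `⨍_Ω |∇η|² + Pe² M(η)` over the admissible `η` that lie in `S`. -/
noncomputable def symmValueOver (Pe : ℝ) (S : Set (Strip lx ly → ℝ)) : EReal :=
  sInf {r : EReal | ∃ (η : Strip lx ly → ℝ) (Dη : Strip lx ly → E3),
    IsSymmAdmissible η Dη ∧ η ∈ S ∧
    r = ((⨍ p, ‖Dη p‖ ^ 2 ∂(layerMeasure lx ly) : ℝ) : EReal)
      + ((Pe ^ 2 : ℝ) : EReal) * transportSup η}

/-- `U_symm(Pe)`. -/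
noncomputable def symmValue (lx ly : ℝ) [Fact (0 < lx)] [Fact (0 < ly)] (Pe : ℝ) : EReal :=
  symmValueOver Pe (Set.univ : Set (Strip lx ly → ℝ))

/-- The value of the same minimization when `η` is required to depend on `z` alone. -/
noncomputable def symmValueVertical (lx ly : ℝ) [Fact (0 < lx)] [Fact (0 < ly)] (Pe : ℝ) :
    EReal :=
  symmValueOver Pe {η : Strip lx ly → ℝ | ∃ τ : ℝ → ℝ, ∀ p, η p = τ p.2.2}

/-- Background fields: `τ ∈ H¹(0,1)` with `τ(0) = 1` and `τ(1) = 0`. -/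
structure IsBackground (τ : ℝ → ℝ) : Prop where
  absCont : AbsolutelyContinuousOnInterval τ 0 1
  memLp_deriv : MemLp (deriv τ) 2 (volume.restrict (Icc (0 : ℝ) 1))
  at_zero : τ 0 = 1
  at_one : τ 1 = 0

/-- `H_{τ,lam}(u, θ) = ⨍_Ω (lam/2) |∇u|² + (1/2) |∇θ|² + w θ τ'(z)`. -/
noncomputable def backgroundForm (τ : ℝ → ℝ) (lam : ℝ) (u : Fin 3 → Strip lx ly → ℝ)
    (Du : Fin 3 → Strip lx ly → E3) (θ : Strip lx ly → ℝ) (Dθ : Strip lx ly → E3) : ℝ :=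
  ⨍ p, (lam / 2 * ∑ i, ‖Du i p‖ ^ 2 + 1 / 2 * ‖Dθ p‖ ^ 2 + u 2 p * θ p * deriv τ p.2.2)
    ∂(layerMeasure lx ly)

/-- `H_{τ,lam} ≥ 0`: the background field is spectrally stable at Lagrange multiplier `lam`. -/
def SpectrallyStable (lx ly : ℝ) [Fact (0 < lx)] [Fact (0 < ly)] (τ : ℝ → ℝ) (lam : ℝ) : Prop :=
  ∀ (u : Fin 3 → Strip lx ly → ℝ) (Du : Fin 3 → Strip lx ly → E3)
    (θ : Strip lx ly → ℝ) (Dθ : Strip lx ly → E3),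
    IsNoSlipFlow u Du → MemH10 θ Dθ → 0 ≤ backgroundForm τ lam u Du θ Dθ

/-- `U_bm(Pe)`: the infimum of `∫₀¹ |τ'|² + lam Pe²` over `τ` and `lam` with `H_{τ,lam} ≥ 0`. -/
noncomputable def bmValue (lx ly : ℝ) [Fact (0 < lx)] [Fact (0 < ly)] (Pe : ℝ) : EReal :=
  sInf {r : EReal | ∃ (τ : ℝ → ℝ) (lam : ℝ),
    IsBackground τ ∧ SpectrallyStable lx ly τ lam ∧
    r = (((∫ z in (0 : ℝ)..1, deriv τ z ^ 2) + lam * Pe ^ 2 : ℝ) : EReal)}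

end Layer

/-! Both problems are governed by one quadratic inequality. Since `u` is divergence-free and `θ`
vanishes on the walls, integration by parts turns `∫ w θ τ'` into `-∫ (u τ) · ∇θ`. Completing the
square in `θ` then shows that `H_{τ,λ} ≥ 0` says exactly that `⨍ |∇Δ⁻¹ div(u τ)|² ≤ λ ⨍ |∇u|²`, the
minimizing `θ` being `Δ⁻¹ div(u τ)`. So for a field depending on `z` alone, the least admissible `λ`
is the supremum in the symmetrization functional.

Every background field is admissible for symmetrization, and its supremum is at most `λ`
(`transportSup_le_of_spectrallyStable`). Hence the vertical symmetrization value is at most the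
background value.

Conversely, let `η` be admissible with supremum `m`. By duality, `⨍ (u η) · ∇θ ≤ (m/2) ⨍ |∇u|² +
(1/2) ⨍ |∇θ|²` for all `u`, `θ` (`average_inner_flux_le`). The left side is linear in `η`, and the
right side is invariant under horizontal translations of `u` and `θ`. Averaging over translations
therefore gives the same inequality for the horizontal mean of `η`
(`average_inner_flux_horizontalMean_le`), so this mean is spectrally stable at `λ = m`. Jensen's
inequality shows that its Dirichlet energy is no larger (`IsSymmAdmissible.exists_background`). Thus
the background value is at most the full symmetrization value, which is trivially at most the
vertical one, and the three values coincide.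

The analytic work lies in the low regularity: `τ'` is only in `L²(0,1)`, so even the integrability
of `w θ τ'` rests on a Poincaré inequality weighted by `|τ'|`. The gradients in the definition of
`H¹₀` are reached through limits of test functions. -/

/-- The covering map `ℝ³ → 𝕋² × ℝ`. -/
def stripMk (lx ly : ℝ) (q : ℝ × ℝ × ℝ) : Strip lx ly :=
  ((q.1 : AddCircle lx), (q.2.1 : AddCircle ly), q.2.2)

/-- The coordinate directions of the strip. -/
def stripDir : Fin 3 → ℝ × ℝ × ℝ := ![(1, 0, 0), (0, 1, 0), (0, 0, 1)]

/-! ### Calculus of test functions on the periodic strip -/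

section TestFunctions

variable {lx ly : ℝ} {φ ψ : Strip lx ly → ℝ}

theorem stripMk_add (a b : ℝ × ℝ × ℝ) :
    stripMk lx ly (a + b) = stripMk lx ly a + stripMk lx ly b := by
  simp [stripMk]

/-- Continuity on the strip can thus be checked on `ℝ³`, where smoothness of test functions is
formulated. -/
theorem isOpenQuotientMap_stripMk : IsOpenQuotientMap (stripMk lx ly) :=
  (QuotientAddGroup.isOpenQuotientMap_mk (N := AddSubgroup.zmultiples lx)).prodMap
    ((QuotientAddGroup.isOpenQuotientMap_mk (N := AddSubgroup.zmultiples ly)).prodMap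
      IsOpenQuotientMap.id)

theorem stripGrad_apply (φ : Strip lx ly → ℝ) (p : Strip lx ly) (i : Fin 3) :
    stripGrad φ p i = deriv (fun s : ℝ => φ (p + stripMk lx ly (s • stripDir i))) 0 := by
  obtain ⟨x, y, z⟩ := p
  fin_cases i <;> simp [stripGrad, stripMk, stripDir]

theorem stripGrad_eq_of_hasDerivAt {p : Strip lx ly} {g : E3}
    (h : ∀ i, HasDerivAt (fun s : ℝ => φ (p + stripMk lx ly (s • stripDir i))) (g i) 0) :
    stripGrad φ p = g := by
  ext i
  rw [stripGrad_apply, (h i).deriv]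

theorem hasDerivAt_of_contDiff_lift
    (hφ : ContDiff ℝ ∞ (fun q : ℝ × ℝ × ℝ => φ (stripMk lx ly q))) (q : ℝ × ℝ × ℝ) (i : Fin 3) :
    HasDerivAt (fun s : ℝ => φ (stripMk lx ly q + stripMk lx ly (s • stripDir i)))
      (fderiv ℝ (fun q : ℝ × ℝ × ℝ => φ (stripMk lx ly q)) q (stripDir i)) 0 := by
  simp only [← stripMk_add]
  have h1 : HasFDerivAt (fun q : ℝ × ℝ × ℝ => φ (stripMk lx ly q))
      (fderiv ℝ (fun q : ℝ × ℝ × ℝ => φ (stripMk lx ly q)) q) (q + (0 : ℝ) • stripDir i) := by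
    rw [zero_smul, add_zero]
    exact (hφ.differentiable (by simp) q).hasFDerivAt
  have h2 : HasDerivAt (fun s : ℝ => q + s • stripDir i) (stripDir i) 0 := by
    simpa using ((hasDerivAt_id (0 : ℝ)).smul_const (stripDir i)).const_add q
  exact h1.comp_hasDerivAt (0 : ℝ) h2

namespace IsTestFunction

theorem contDiff_lift (hφ : IsTestFunction φ) :
    ContDiff ℝ ∞ (fun q : ℝ × ℝ × ℝ => φ (stripMk lx ly q)) := hφ.smooth

theorem hasDerivAt (hφ : IsTestFunction φ) (p : Strip lx ly) (i : Fin 3) :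
    HasDerivAt (fun s : ℝ => φ (p + stripMk lx ly (s • stripDir i))) (stripGrad φ p i) 0 := by
  obtain ⟨q, rfl⟩ := isOpenQuotientMap_stripMk.surjective p
  rw [stripGrad_apply]
  exact (hasDerivAt_of_contDiff_lift hφ.contDiff_lift q i).differentiableAt.hasDerivAt

theorem hasDerivAt_shift (hφ : IsTestFunction φ) (p : Strip lx ly) (i : Fin 3) (t : ℝ) :
    HasDerivAt (fun s : ℝ => φ (p + stripMk lx ly (s • stripDir i)))
      (stripGrad φ (p + stripMk lx ly (t • stripDir i)) i) t := by
  have h := hφ.hasDerivAt (p + stripMk lx ly (t • stripDir i)) i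
  have h2 : HasDerivAt (fun s : ℝ => s - t) 1 t := (hasDerivAt_id t).sub_const t
  have h3 := HasDerivAt.comp (h₂ := fun s : ℝ =>
    φ (p + stripMk lx ly (t • stripDir i) + stripMk lx ly (s • stripDir i))) t
    (by rw [sub_self]; exact h) h2
  rw [mul_one] at h3
  have h4 : (fun s : ℝ => φ (p + stripMk lx ly (s • stripDir i))) =
      (fun s : ℝ => φ (p + stripMk lx ly (t • stripDir i) + stripMk lx ly (s • stripDir i))) ∘
        fun s : ℝ => s - t := by
    funext s
    simp only [Function.comp]
    rw [add_assoc, ← stripMk_add, ← add_smul, add_sub_cancel]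
  exact h4 ▸ h3

theorem continuous (hφ : IsTestFunction φ) : Continuous φ :=
  isOpenQuotientMap_stripMk.isQuotientMap.continuous_iff.2 hφ.contDiff_lift.continuous

theorem continuous_stripGrad (hφ : IsTestFunction φ) : Continuous (stripGrad φ) := by
  refine isOpenQuotientMap_stripMk.isQuotientMap.continuous_iff.2 ?_
  refine (PiLp.continuous_toLp 2 (fun _ : Fin 3 => ℝ)).comp
    (f := fun q i => stripGrad φ (stripMk lx ly q) i) (continuous_pi fun i => ?_)
  have : (fun q => stripGrad φ (stripMk lx ly q) i) = fun q =>
      fderiv ℝ (fun q : ℝ × ℝ × ℝ => φ (stripMk lx ly q)) q (stripDir i) := by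
    funext q
    rw [stripGrad_apply, (hasDerivAt_of_contDiff_lift hφ.contDiff_lift q i).deriv]
  rw [this]
  exact (hφ.contDiff_lift.continuous_fderiv (by simp)).clm_apply continuous_const

theorem eq_zero (hφ : IsTestFunction φ) {p : Strip lx ly} (hp : p.2.2 ∉ Ioo (0 : ℝ) 1) :
    φ p = 0 :=
  image_eq_zero_of_notMem_tsupport fun h => hp (hφ.support h)

theorem zero : IsTestFunction (fun _ : Strip lx ly => (0 : ℝ)) where
  smooth := contDiff_const
  compact := HasCompactSupport.zero
  support := by
    rw [show (fun _ : Strip lx ly => (0 : ℝ)) = 0 from rfl, tsupport_zero]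
    exact empty_subset _

theorem add (hφ : IsTestFunction φ) (hψ : IsTestFunction ψ) :
    IsTestFunction (fun p => φ p + ψ p) where
  smooth := hφ.smooth.add hψ.smooth
  compact := hφ.compact.add hψ.compact
  support := (tsupport_add φ ψ).trans (union_subset hφ.support hψ.support)

theorem mul_left (hφ : IsTestFunction φ) {g : Strip lx ly → ℝ}
    (hg : ContDiff ℝ ∞ (fun q : ℝ × ℝ × ℝ => g (stripMk lx ly q))) :
    IsTestFunction (fun p => g p * φ p) where
  smooth := hg.mul hφ.smooth
  compact := hφ.compact.mul_left
  support := (tsupport_mul_subset_right (f := g) (g := φ)).trans hφ.support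

theorem mul (hφ : IsTestFunction φ) (hψ : IsTestFunction ψ) :
    IsTestFunction (fun p => φ p * ψ p) := hψ.mul_left hφ.contDiff_lift

theorem const_mul (hφ : IsTestFunction φ) (c : ℝ) : IsTestFunction (fun p => c * φ p) :=
  hφ.mul_left contDiff_const

theorem stripGrad_add (hφ : IsTestFunction φ) (hψ : IsTestFunction ψ) (p : Strip lx ly) :
    stripGrad (fun p => φ p + ψ p) p = stripGrad φ p + stripGrad ψ p :=
  stripGrad_eq_of_hasDerivAt fun i => (hφ.hasDerivAt p i).add (hψ.hasDerivAt p i)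

theorem stripGrad_const_mul (hφ : IsTestFunction φ) (c : ℝ) (p : Strip lx ly) :
    stripGrad (fun p => c * φ p) p = c • stripGrad φ p :=
  stripGrad_eq_of_hasDerivAt fun i => (hφ.hasDerivAt p i).const_mul c

theorem stripGrad_mul (hφ : IsTestFunction φ) (hψ : IsTestFunction ψ) (p : Strip lx ly) :
    stripGrad (fun p => φ p * ψ p) p = ψ p • stripGrad φ p + φ p • stripGrad ψ p := by
  refine stripGrad_eq_of_hasDerivAt fun i => ?_
  have h := (hφ.hasDerivAt p i).mul (hψ.hasDerivAt p i)
  have h0 : p + stripMk lx ly ((0 : ℝ) • stripDir i) = p := by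
    obtain ⟨x, y, z⟩ := p
    simp [stripMk]
  rw [h0] at h
  rwa [show (ψ p • stripGrad φ p + φ p • stripGrad ψ p) i =
    stripGrad φ p i * ψ p + φ p * stripGrad ψ p i by simp [mul_comm]]

end IsTestFunction

theorem stripGrad_comp_add_right (φ : Strip lx ly → ℝ) (a p : Strip lx ly) :
    stripGrad (fun p => φ (p + a)) p = stripGrad φ (p + a) := by
  ext i
  simp only [stripGrad_apply, add_right_comm]

theorem IsTestFunction.comp_add_right (hφ : IsTestFunction φ) {a : Strip lx ly} (ha : a.2.2 = 0) :
    IsTestFunction (fun p => φ (p + a)) where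
  smooth := by
    obtain ⟨b, rfl⟩ := isOpenQuotientMap_stripMk.surjective a
    have : (fun q : ℝ × ℝ × ℝ => φ (stripMk lx ly q + stripMk lx ly b)) =
        (fun q : ℝ × ℝ × ℝ => φ (stripMk lx ly q)) ∘ fun q => q + b := by
      funext q; simp only [Function.comp, stripMk_add]
    exact this ▸ hφ.contDiff_lift.comp (contDiff_id.add contDiff_const)
  compact := hφ.compact.comp_homeomorph (Homeomorph.addRight a)
  support := by
    have h := tsupport_comp_eq_preimage φ (Homeomorph.addRight a)
    intro p hp
    have h2 : p + a ∈ tsupport φ := by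
      have : p ∈ tsupport (φ ∘ Homeomorph.addRight a) := hp
      rw [h] at this
      exact this
    have h3 := hφ.support h2
    simpa [openLayer, ha] using h3

/-- A smooth function of `z`, compactly supported in `(0,1)`, is a test function. -/
theorem isTestFunction_of_vertical [Fact (0 < lx)] [Fact (0 < ly)] {f : ℝ → ℝ}
    (hf : ContDiff ℝ ∞ f) (hc : HasCompactSupport f) (hs : tsupport f ⊆ Ioo 0 1) :
    IsTestFunction (fun p : Strip lx ly => f p.2.2) := by
  have hsub : tsupport (fun p : Strip lx ly => f p.2.2) ⊆ univ ×ˢ (univ ×ˢ tsupport f) := by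
    refine closure_minimal (fun p hp => ⟨mem_univ _, mem_univ _, subset_tsupport _ hp⟩) ?_
    exact isClosed_univ.prod (isClosed_univ.prod (isClosed_tsupport f))
  refine ⟨?_, ?_, fun p hp => hs (hsub hp).2.2⟩
  · change ContDiff ℝ ∞ (fun q : ℝ × ℝ × ℝ => f q.2.2)
    exact hf.comp (contDiff_snd.comp contDiff_snd)
  exact (isCompact_univ.prod (isCompact_univ.prod hc)).of_isClosed_subset
    (isClosed_tsupport _) hsub

theorem stripGrad_vertical {f : ℝ → ℝ} (hf : Differentiable ℝ f) (p : Strip lx ly) :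
    stripGrad (fun p : Strip lx ly => f p.2.2) p = !₂[(0 : ℝ), 0, deriv f p.2.2] := by
  refine stripGrad_eq_of_hasDerivAt fun i => ?_
  have h : HasDerivAt (fun s => f (p.2.2 + s)) (deriv f p.2.2) 0 := by
    apply HasDerivAt.comp_const_add
    simpa using (hf p.2.2).hasDerivAt
  fin_cases i
  · simpa [stripMk, stripDir] using hasDerivAt_const (0 : ℝ) (f p.2.2)
  · simpa [stripMk, stripDir] using hasDerivAt_const (0 : ℝ) (f p.2.2)
  · simpa [stripMk, stripDir] using h

end TestFunctions

/-! ### General `L²` estimates and the unit interval -/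

theorem lintegral_enorm_sq_le {α E : Type*} [MeasurableSpace α] [NormedAddCommGroup E]
    {m : Measure α} [IsProbabilityMeasure m] {f : α → E} (hf : AEStronglyMeasurable f m) :
    (∫⁻ a, ‖f a‖ₑ ∂m) ^ 2 ≤ ∫⁻ a, ‖f a‖ₑ ^ 2 ∂m := by
  have h := eLpNorm_le_eLpNorm_of_exponent_le (p := 1) (q := 2) (by norm_num) hf
  rw [eLpNorm_one_eq_lintegral_enorm] at h
  calc _ ≤ (eLpNorm f 2 m) ^ 2 := pow_le_pow_left' h 2
    _ = _ := by
      have := eLpNorm_nnreal_pow_eq_lintegral (μ := m) (f := f) (p := 2) (by norm_num)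
      norm_num at this
      exact_mod_cast this

theorem eLpNorm_two_sq {α E : Type*} [MeasurableSpace α] [NormedAddCommGroup E]
    {m : Measure α} {f : α → E} :
    (eLpNorm f 2 m) ^ 2 = ∫⁻ a, ‖f a‖ₑ ^ 2 ∂m := by
  have := eLpNorm_nnreal_pow_eq_lintegral (μ := m) (f := f) (p := 2) (by norm_num)
  norm_num at this
  exact_mod_cast this

theorem tendsto_integral_inner {α E : Type*} [MeasurableSpace α] [NormedAddCommGroup E]
    [InnerProductSpace ℝ E] {m : Measure α} {f : ℕ → α → E} {g h : α → E}
    (hg : MemLp g 2 m) (hf : ∀ n, MemLp (f n) 2 m) (hh : MemLp h 2 m)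
    (hlim : Tendsto (fun n => eLpNorm (fun a => f n a - h a) 2 m) atTop (𝓝 0)) :
    Tendsto (fun n => ∫ a, inner ℝ (g a) (f n a) ∂m) atTop (𝓝 (∫ a, inner ℝ (g a) (h a) ∂m)) := by
  have key : ∀ {k : α → E} (hk : MemLp k 2 m),
      ∫ a, inner ℝ (g a) (k a) ∂m = inner ℝ (hg.toLp g) (hk.toLp k) := by
    intro k hk
    rw [L2.inner_def]
    refine integral_congr_ae ?_
    filter_upwards [hg.coeFn_toLp, hk.coeFn_toLp] with a h1 h2
    rw [h1, h2]
  have hL : Tendsto (fun n => (hf n).toLp (f n)) atTop (𝓝 (hh.toLp h)) :=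
    (Lp.tendsto_Lp_iff_tendsto_eLpNorm'' f hf h hh).2 hlim
  rw [key hh]
  simp_rw [key (hf _)]
  exact tendsto_const_nhds.inner hL

/-- Lebesgue measure on the unit interval. -/
noncomputable def unitMeasure : Measure ℝ := volume.restrict (Icc 0 1)

instance : IsProbabilityMeasure unitMeasure := ⟨by simp [unitMeasure]⟩

theorem ae_unitMeasure_mem : ∀ᵐ z ∂unitMeasure, z ∈ Icc (0 : ℝ) 1 :=
  ae_restrict_mem measurableSet_Icc

theorem integral_unitMeasure (f : ℝ → ℝ) : ∫ z, f z ∂unitMeasure = ∫ z in (0 : ℝ)..1, f z := by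
  rw [intervalIntegral.integral_of_le zero_le_one, unitMeasure, integral_Icc_eq_integral_Ioc]

theorem measurableEmbedding_layer {lx ly : ℝ} : MeasurableEmbedding
    (fun q : (AddCircle lx × AddCircle ly) × ℝ => ((q.1.1, q.1.2, q.2) : Strip lx ly)) :=
  (MeasurableEquiv.prodAssoc (α := AddCircle lx) (β := AddCircle ly) (γ := ℝ)).measurableEmbedding

/-- Integrate `∂_z φ` up from the wall `z = 0`, where `φ` vanishes, and apply Cauchy–Schwarz. The
bound does not depend on `z`, so it can later be integrated against any weight in `z`. -/
theorem IsTestFunction.enorm_sq_le {lx ly : ℝ} {φ : Strip lx ly → ℝ} (hφ : IsTestFunction φ)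
    (x : AddCircle lx) (y : AddCircle ly) {z : ℝ} (hz : z ∈ Icc (0 : ℝ) 1) :
    ‖φ (x, y, z)‖ₑ ^ 2 ≤ ∫⁻ t, ‖stripGrad φ (x, y, t)‖ₑ ^ 2 ∂unitMeasure := by
  have hcont : Continuous fun t : ℝ => stripGrad φ (x, y, t) :=
    hφ.continuous_stripGrad.comp (by fun_prop)
  have hcont2 : Continuous fun t : ℝ => stripGrad φ (x, y, t) 2 :=
    (PiLp.continuous_apply 2 (fun _ : Fin 3 => ℝ) 2).comp hcont
  have hd : ∀ t, HasDerivAt (fun s : ℝ => φ (x, y, s)) (stripGrad φ (x, y, t) 2) t := by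
    intro t
    have := hφ.hasDerivAt_shift (x, y, 0) 2 t
    simpa [stripMk, stripDir] using this
  have h0 : φ (x, y, 0) = 0 := hφ.eq_zero (by simp)
  have hint : φ (x, y, z) = ∫ t in (0 : ℝ)..z, stripGrad φ (x, y, t) 2 := by
    rw [intervalIntegral.integral_eq_sub_of_hasDerivAt (fun t _ => hd t)
      (hcont2.intervalIntegrable _ _), h0, sub_zero]
  have h1 : ‖φ (x, y, z)‖ₑ ≤ ∫⁻ t, ‖stripGrad φ (x, y, t)‖ₑ ∂unitMeasure := by
    rw [hint, intervalIntegral.integral_of_le hz.1]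
    refine (enorm_integral_le_lintegral_enorm _).trans ?_
    refine (lintegral_mono' (Measure.restrict_mono (fun t ht => ?_) le_rfl) fun t => ?_)
    · exact ⟨ht.1.le, ht.2.trans hz.2⟩
    · exact enorm_le_iff_norm_le.2 (PiLp.norm_apply_le _ _)
  exact (pow_le_pow_left' h1 2).trans (lintegral_enorm_sq_le hcont.aestronglyMeasurable)

/-! ### Fubini, horizontal translations and the weighted Poincaré inequality on the layer -/

section LayerMeasure

variable {lx ly : ℝ} [hlx : Fact (0 < lx)] [hly : Fact (0 < ly)]

theorem layerMeasure_eq_prod : layerMeasure lx ly =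
    (volume : Measure (AddCircle lx)).prod ((volume : Measure (AddCircle ly)).prod unitMeasure) := by
  have : {p : Strip lx ly | p.2.2 ∈ Icc (0 : ℝ) 1} =
      (univ : Set (AddCircle lx)) ×ˢ ((univ : Set (AddCircle ly)) ×ˢ Icc (0 : ℝ) 1) := by
    ext p; simp
  rw [layerMeasure, this, Measure.volume_eq_prod, ← Measure.prod_restrict, Measure.volume_eq_prod,
    ← Measure.prod_restrict, Measure.restrict_univ, Measure.restrict_univ, unitMeasure]

instance : IsFiniteMeasure (layerMeasure lx ly) := by
  rw [layerMeasure_eq_prod]; infer_instance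

theorem ae_layerMeasure_mem : ∀ᵐ p ∂(layerMeasure lx ly), p.2.2 ∈ Icc (0 : ℝ) 1 :=
  ae_restrict_mem (measurable_snd.snd measurableSet_Icc)

/-- Fubini on the layer, with the vertical variable last. -/
theorem measurePreserving_layer : MeasurePreserving
    (fun q : (AddCircle lx × AddCircle ly) × ℝ => ((q.1.1, q.1.2, q.2) : Strip lx ly))
    ((volume : Measure (AddCircle lx × AddCircle ly)).prod unitMeasure) (layerMeasure lx ly) := by
  rw [layerMeasure_eq_prod, Measure.volume_eq_prod]
  exact measurePreserving_prodAssoc _ _ _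

theorem volume_torus :
    (volume : Measure (AddCircle lx × AddCircle ly)) univ = ENNReal.ofReal (lx * ly) := by
  rw [Measure.volume_eq_prod, ← univ_prod_univ, Measure.prod_prod]
  simp [ENNReal.ofReal_mul hlx.out.le]

theorem layer_area_pos : 0 < lx * ly := mul_pos hlx.out hly.out

theorem map_height_layerMeasure : (layerMeasure lx ly).map (fun p => p.2.2) =
    ENNReal.ofReal (lx * ly) • unitMeasure := by
  rw [← measurePreserving_layer.map_eq, Measure.map_map measurable_snd.snd
    measurePreserving_layer.measurable, ← volume_torus]
  exact Measure.map_snd_prod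

theorem average_layer (f : Strip lx ly → ℝ) :
    ⨍ p, f p ∂(layerMeasure lx ly) = (lx * ly)⁻¹ * ∫ p, f p ∂(layerMeasure lx ly) := by
  have h : (layerMeasure lx ly) univ = ENNReal.ofReal (lx * ly) := by
    have := congrArg (fun m => m univ) (map_height_layerMeasure (lx := lx) (ly := ly))
    simpa [Measure.map_apply measurable_snd.snd MeasurableSet.univ] using this
  rw [average_eq, measureReal_def, h, ENNReal.toReal_ofReal layer_area_pos.le, smul_eq_mul]

theorem quasiMeasurePreserving_height :
    Measure.QuasiMeasurePreserving (fun p : Strip lx ly => p.2.2) (layerMeasure lx ly)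
      unitMeasure :=
  ⟨measurable_snd.snd, by
    rw [map_height_layerMeasure]; exact Measure.smul_absolutelyContinuous⟩

theorem integral_height {f : ℝ → ℝ} (hf : AEStronglyMeasurable f unitMeasure) :
    ∫ p, f p.2.2 ∂(layerMeasure lx ly) = lx * ly * ∫ z, f z ∂unitMeasure := by
  rw [← integral_map (f := f) (φ := fun p : Strip lx ly => p.2.2) measurable_snd.snd.aemeasurable,
    map_height_layerMeasure, integral_smul_measure, ENNReal.toReal_ofReal layer_area_pos.le,
    smul_eq_mul]
  rw [map_height_layerMeasure]
  exact hf.mono_ac Measure.smul_absolutelyContinuous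

theorem eLpNorm_height {E : Type*} [NormedAddCommGroup E] {f : ℝ → E} {q : ℝ≥0∞} (hq : q ≠ ⊤)
    (hf : AEStronglyMeasurable f unitMeasure) :
    eLpNorm (fun p => f p.2.2) q (layerMeasure lx ly) =
      ENNReal.ofReal (lx * ly) ^ (1 / q).toReal * eLpNorm f q unitMeasure := by
  have h := eLpNorm_map_measure (μ := layerMeasure lx ly) (g := f) (p := q)
    (f := fun p => p.2.2) (by
      rw [map_height_layerMeasure]; exact hf.mono_ac Measure.smul_absolutelyContinuous)
    measurable_snd.snd.aemeasurable
  rw [map_height_layerMeasure, eLpNorm_smul_measure_of_ne_top hq] at h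
  exact h.symm

theorem memLp_height {E : Type*} [NormedAddCommGroup E] {f : ℝ → E} {q : ℝ≥0∞} (hq : q ≠ ⊤)
    (hf : MemLp f q unitMeasure) : MemLp (fun p => f p.2.2) q (layerMeasure lx ly) := by
  refine ⟨hf.1.comp_quasiMeasurePreserving quasiMeasurePreserving_height, ?_⟩
  rw [eLpNorm_height hq hf.1]
  exact ENNReal.mul_lt_top (ENNReal.rpow_lt_top_of_nonneg (by simp) (by simp)) hf.2

theorem measurePreserving_add_horizontal {a : Strip lx ly} (ha : a.2.2 = 0) :
    MeasurePreserving (fun p : Strip lx ly => p + a) (layerMeasure lx ly) (layerMeasure lx ly) := by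
  rw [layerMeasure_eq_prod]
  convert (measurePreserving_add_right (volume : Measure (AddCircle lx)) a.1).prod
    ((measurePreserving_add_right (volume : Measure (AddCircle ly)) a.2.1).prod
      (MeasurePreserving.id unitMeasure)) using 1
  funext p
  simp [Prod.ext_iff, ha]

theorem exists_bound_layer {E : Type*} [NormedAddCommGroup E] {f : Strip lx ly → E}
    (hf : Continuous f) : ∃ C, ∀ p : Strip lx ly, p.2.2 ∈ Icc (0 : ℝ) 1 → ‖f p‖ ≤ C := by
  have hK : IsCompact ((univ : Set (AddCircle lx)) ×ˢ ((univ : Set (AddCircle ly)) ×ˢ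
      Icc (0 : ℝ) 1)) := isCompact_univ.prod (isCompact_univ.prod isCompact_Icc)
  obtain ⟨C, hC⟩ := hK.exists_bound_of_continuousOn hf.continuousOn
  exact ⟨C, fun p hp => hC p ⟨mem_univ _, mem_univ _, hp⟩⟩

theorem Continuous.memLp_layer {E : Type*} [NormedAddCommGroup E] {f : Strip lx ly → E}
    (hf : Continuous f) (q : ℝ≥0∞) : MemLp f q (layerMeasure lx ly) := by
  obtain ⟨C, hC⟩ := exists_bound_layer hf
  exact MemLp.of_bound hf.aestronglyMeasurable C (ae_layerMeasure_mem.mono hC)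

/-- The vertical-line bound `IsTestFunction.enorm_sq_le` is multiplied by `ρ(z)` and integrated. No
boundedness of `ρ` is used, which permits the weight `|τ'|`. -/
theorem IsTestFunction.weighted_poincare {φ : Strip lx ly → ℝ} (hφ : IsTestFunction φ)
    {ρ : ℝ → ℝ≥0∞} (hρ : Measurable ρ) :
    ∫⁻ p, ρ p.2.2 * ‖φ p‖ₑ ^ 2 ∂(layerMeasure lx ly) ≤
      (∫⁻ z, ρ z ∂unitMeasure) * ∫⁻ p, ‖stripGrad φ p‖ₑ ^ 2 ∂(layerMeasure lx ly) := by
  have hm1 : Measurable fun p : Strip lx ly => ρ p.2.2 * ‖φ p‖ₑ ^ 2 :=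
    (hρ.comp measurable_snd.snd).mul (hφ.continuous.measurable.enorm.pow_const 2)
  have hm2 : Measurable fun p : Strip lx ly => ‖stripGrad φ p‖ₑ ^ 2 :=
    hφ.continuous_stripGrad.measurable.enorm.pow_const 2
  rw [← measurePreserving_layer.lintegral_comp hm1, ← measurePreserving_layer.lintegral_comp hm2,
    lintegral_prod _ (by exact (hm1.comp measurePreserving_layer.measurable).aemeasurable),
    lintegral_prod _ (by exact (hm2.comp measurePreserving_layer.measurable).aemeasurable),
    ← lintegral_const_mul _ (by
      exact (hm2.comp measurePreserving_layer.measurable).lintegral_prod_right')]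
  refine lintegral_mono fun q => ?_
  rw [← lintegral_mul_const _ hρ]
  refine lintegral_mono_ae (ae_unitMeasure_mem.mono fun z hz => ?_)
  exact mul_le_mul_right (hφ.enorm_sq_le q.1 q.2 hz) _

end LayerMeasure

/-! ### The space `H¹₀` and the weak Dirichlet problem -/

section Sobolev

variable {lx ly : ℝ} [hlx : Fact (0 < lx)] [hly : Fact (0 < ly)]
  {φ v w : Strip lx ly → ℝ} {G K : Strip lx ly → E3}

theorem tendsto_eLpNorm_add {E : Type*} [NormedAddCommGroup E] {f g : ℕ → Strip lx ly → E}
    (hfm : ∀ n, AEStronglyMeasurable (f n) (layerMeasure lx ly))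
    (hgm : ∀ n, AEStronglyMeasurable (g n) (layerMeasure lx ly))
    (hf : Tendsto (fun n => eLpNorm (f n) 2 (layerMeasure lx ly)) atTop (𝓝 0))
    (hg : Tendsto (fun n => eLpNorm (g n) 2 (layerMeasure lx ly)) atTop (𝓝 0)) :
    Tendsto (fun n => eLpNorm (f n + g n) 2 (layerMeasure lx ly)) atTop (𝓝 0) := by
  refine tendsto_of_tendsto_of_tendsto_of_le_of_le tendsto_const_nhds
    (by simpa using hf.add hg) (fun n => zero_le) fun n => ?_
  exact eLpNorm_add_le (hfm n) (hgm n) (by norm_num)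

namespace IsTestFunction

theorem memLp (hφ : IsTestFunction φ) (q : ℝ≥0∞) : MemLp φ q (layerMeasure lx ly) :=
  hφ.continuous.memLp_layer q

theorem memLp_stripGrad (hφ : IsTestFunction φ) (q : ℝ≥0∞) :
    MemLp (stripGrad φ) q (layerMeasure lx ly) :=
  hφ.continuous_stripGrad.memLp_layer q

theorem memH10 (hφ : IsTestFunction φ) : MemH10 φ (stripGrad φ) :=
  ⟨hφ.memLp 2, hφ.memLp_stripGrad 2, fun _ => φ, fun _ => hφ, by simp, by simp⟩

end IsTestFunction

namespace MemH10

theorem congr (hv : MemH10 v G) (hvw : v =ᵐ[layerMeasure lx ly] w)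
    (hGK : G =ᵐ[layerMeasure lx ly] K) : MemH10 w K := by
  obtain ⟨φ, hφ, h1, h2⟩ := hv.approx
  refine ⟨hv.memLp.ae_eq hvw, hv.memLp_grad.ae_eq hGK, φ, hφ, ?_, ?_⟩
  · convert h1 using 2 with n
    exact eLpNorm_congr_ae (hvw.mono fun p hp => by simp only [hp])
  · convert h2 using 2 with n
    exact eLpNorm_congr_ae (hGK.mono fun p hp => by simp only [hp])

theorem const_mul (hv : MemH10 v G) (c : ℝ) :
    MemH10 (fun p => c * v p) (fun p => c • G p) := by
  obtain ⟨φ, hφ, h1, h2⟩ := hv.approx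
  refine ⟨hv.memLp.const_mul c, hv.memLp_grad.const_smul c, fun n p => c * φ n p,
    fun n => (hφ n).const_mul c, ?_, ?_⟩
  · have := ENNReal.Tendsto.const_mul (a := ‖c‖ₑ) h1 (Or.inr (by simp))
    rw [mul_zero] at this
    convert this using 2 with n
    rw [← eLpNorm_const_smul]
    congr 1
    funext p
    simp [mul_sub]
  · have := ENNReal.Tendsto.const_mul (a := ‖c‖ₑ) h2 (Or.inr (by simp))
    rw [mul_zero] at this
    convert this using 2 with n
    rw [← eLpNorm_const_smul]
    congr 1
    funext p
    simp [(hφ n).stripGrad_const_mul, smul_sub]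

theorem add (hv : MemH10 v G) (hw : MemH10 w K) :
    MemH10 (fun p => v p + w p) (fun p => G p + K p) := by
  obtain ⟨φ, hφ, h1, h2⟩ := hv.approx
  obtain ⟨ψ, hψ, h3, h4⟩ := hw.approx
  refine ⟨hv.memLp.add hw.memLp, hv.memLp_grad.add hw.memLp_grad, fun n p => φ n p + ψ n p,
    fun n => (hφ n).add (hψ n), ?_, ?_⟩
  · convert tendsto_eLpNorm_add (fun n => (((hφ n).memLp 2).sub hv.memLp).1)
      (fun n => (((hψ n).memLp 2).sub hw.memLp).1) h1 h3 using 3 with n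
    funext p
    simp only [Pi.add_apply, Pi.sub_apply]
    ring
  · convert tendsto_eLpNorm_add (fun n => (((hφ n).memLp_stripGrad 2).sub hv.memLp_grad).1)
      (fun n => (((hψ n).memLp_stripGrad 2).sub hw.memLp_grad).1) h2 h4 using 3 with n
    funext p
    simp only [Pi.add_apply, Pi.sub_apply, (hφ n).stripGrad_add (hψ n)]
    abel

theorem sub (hv : MemH10 v G) (hw : MemH10 w K) :
    MemH10 (fun p => v p - w p) (fun p => G p - K p) := by
  simpa [sub_eq_add_neg] using hv.add (hw.const_mul (-1))

theorem comp_add_right (hv : MemH10 v G) {a : Strip lx ly} (ha : a.2.2 = 0) :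
    MemH10 (fun p => v (p + a)) (fun p => G (p + a)) := by
  obtain ⟨φ, hφ, h1, h2⟩ := hv.approx
  have hT := measurePreserving_add_horizontal ha
  refine ⟨hv.memLp.comp_measurePreserving hT, hv.memLp_grad.comp_measurePreserving hT,
    fun n p => φ n (p + a), fun n => (hφ n).comp_add_right ha, ?_, ?_⟩
  · convert h1 using 2 with n
    exact eLpNorm_comp_measurePreserving (g := fun p => φ n p - v p)
      (((hφ n).memLp 2).sub hv.memLp).1 hT
  · convert h2 using 2 with n
    simp only [stripGrad_comp_add_right]
    exact eLpNorm_comp_measurePreserving (g := fun p => stripGrad (φ n) p - G p)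
      (((hφ n).memLp_stripGrad 2).sub hv.memLp_grad).1 hT

/-- A linear relation between a function and its gradient, valid for test functions, holds on
`H¹₀`. -/
theorem integral_relation {A : Strip lx ly → ℝ} {B : Strip lx ly → E3}
    (hA : MemLp A 2 (layerMeasure lx ly)) (hB : MemLp B 2 (layerMeasure lx ly))
    (h : ∀ φ : Strip lx ly → ℝ, IsTestFunction φ →
      ∫ p, A p * φ p ∂(layerMeasure lx ly) +
        ∫ p, inner ℝ (B p) (stripGrad φ p) ∂(layerMeasure lx ly) = 0)
    (hv : MemH10 v G) :
    ∫ p, A p * v p ∂(layerMeasure lx ly) + ∫ p, inner ℝ (B p) (G p) ∂(layerMeasure lx ly) = 0 := by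
  obtain ⟨φ, hφ, h1, h2⟩ := hv.approx
  have t1 := tendsto_integral_inner hA (fun n => (hφ n).memLp 2) hv.memLp h1
  have t2 := tendsto_integral_inner hB (fun n => (hφ n).memLp_stripGrad 2) hv.memLp_grad h2
  have t3 := t1.add t2
  simp only [RCLike.inner_apply, conj_trivial, mul_comm _ (A _)] at t3
  simp only [fun n => h (φ n) (hφ n)] at t3
  exact tendsto_nhds_unique t3 tendsto_const_nhds

/-- Fatou's lemma along an almost everywhere convergent subsequence of the approximants. Convergence
in unweighted `L²` alone would not control the weighted integral, since `ρ` may be unbounded. -/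
theorem weighted_poincare (hv : MemH10 v G) {ρ : ℝ → NNReal} (hρ : Measurable ρ)
    (hρi : ∫⁻ z, ρ z ∂unitMeasure ≠ ⊤) :
    ∫⁻ p, ρ p.2.2 * ‖v p‖ₑ ^ 2 ∂(layerMeasure lx ly) ≤
      (∫⁻ z, ρ z ∂unitMeasure) * ∫⁻ p, ‖G p‖ₑ ^ 2 ∂(layerMeasure lx ly) := by
  obtain ⟨φ, hφ, h1, h2⟩ := hv.approx
  obtain ⟨ns, hns, hae⟩ := (tendstoInMeasure_of_tendsto_eLpNorm (p := 2) (by norm_num)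
    (fun n => ((hφ n).memLp 2).1) hv.memLp.1 h1).exists_seq_tendsto_ae
  have hm : ∀ n, Measurable fun p : Strip lx ly => (ρ p.2.2 : ℝ≥0∞) * ‖φ (ns n) p‖ₑ ^ 2 :=
    fun n => (hρ.coe_nnreal_ennreal.comp measurable_snd.snd).mul
      ((hφ (ns n)).continuous.measurable.enorm.pow_const 2)
  have hlim : Tendsto (fun n => (∫⁻ z, ρ z ∂unitMeasure) *
      (eLpNorm G 2 (layerMeasure lx ly) +
        eLpNorm (fun p => stripGrad (φ (ns n)) p - G p) 2 (layerMeasure lx ly)) ^ 2) atTop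
      (𝓝 ((∫⁻ z, ρ z ∂unitMeasure) * (eLpNorm G 2 (layerMeasure lx ly) + 0) ^ 2)) :=
    ENNReal.Tendsto.const_mul
      (ENNReal.Tendsto.pow (tendsto_const_nhds.add (h2.comp hns.tendsto_atTop)))
      (Or.inr hρi)
  rw [add_zero, eLpNorm_two_sq] at hlim
  rw [← hlim.liminf_eq]
  calc ∫⁻ p, ρ p.2.2 * ‖v p‖ₑ ^ 2 ∂(layerMeasure lx ly)
      = ∫⁻ p, liminf (fun n => (ρ p.2.2 : ℝ≥0∞) * ‖φ (ns n) p‖ₑ ^ 2) atTop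
          ∂(layerMeasure lx ly) := by
        refine lintegral_congr_ae (hae.mono fun p hp => ?_)
        exact (ENNReal.Tendsto.const_mul (ENNReal.Tendsto.pow hp.enorm)
          (Or.inr (by simp))).liminf_eq.symm
    _ ≤ liminf (fun n => ∫⁻ p, (ρ p.2.2 : ℝ≥0∞) * ‖φ (ns n) p‖ₑ ^ 2 ∂(layerMeasure lx ly))
          atTop := lintegral_liminf_le hm
    _ ≤ _ := by
        refine liminf_le_liminf (Eventually.of_forall fun n => ?_)
        refine ((hφ (ns n)).weighted_poincare hρ.coe_nnreal_ennreal).trans ?_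
        rw [← eLpNorm_two_sq]
        refine mul_le_mul_right (pow_le_pow_left' ?_ 2) _
        have := eLpNorm_add_le (p := 2) hv.memLp_grad.1
          (((hφ (ns n)).memLp_stripGrad 2).sub hv.memLp_grad).1 (by norm_num)
        rwa [add_sub_cancel] at this

theorem poincare (hv : MemH10 v G) :
    ∫⁻ p, ‖v p‖ₑ ^ 2 ∂(layerMeasure lx ly) ≤ ∫⁻ p, ‖G p‖ₑ ^ 2 ∂(layerMeasure lx ly) := by
  have := hv.weighted_poincare (ρ := fun _ => 1) measurable_const (by simp)
  simpa using this

theorem eLpNorm_le (hv : MemH10 v G) :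
    eLpNorm v 2 (layerMeasure lx ly) ≤ eLpNorm G 2 (layerMeasure lx ly) := by
  have := hv.poincare
  rw [← eLpNorm_two_sq, ← eLpNorm_two_sq] at this
  exact (ENNReal.pow_le_pow_left_iff two_ne_zero).1 this

theorem integral_sq_le (hv : MemH10 v G) :
    ∫ p, v p ^ 2 ∂(layerMeasure lx ly) ≤ ∫ p, ‖G p‖ ^ 2 ∂(layerMeasure lx ly) := by
  have h1 := hv.memLp.integrable_norm_pow two_ne_zero
  have h2 := hv.memLp_grad.integrable_norm_pow two_ne_zero
  have h3 := hv.poincare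
  have e1 : ∫⁻ p, ‖v p‖ₑ ^ 2 ∂(layerMeasure lx ly) =
      ENNReal.ofReal (∫ p, ‖v p‖ ^ 2 ∂(layerMeasure lx ly)) := by
    rw [ofReal_integral_eq_lintegral_ofReal h1 (Eventually.of_forall fun p => by positivity)]
    simp only [ENNReal.ofReal_pow (norm_nonneg _), ofReal_norm]
  have e2 : ∫⁻ p, ‖G p‖ₑ ^ 2 ∂(layerMeasure lx ly) =
      ENNReal.ofReal (∫ p, ‖G p‖ ^ 2 ∂(layerMeasure lx ly)) := by
    rw [ofReal_integral_eq_lintegral_ofReal h2 (Eventually.of_forall fun p => by positivity)]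
    simp only [ENNReal.ofReal_pow (norm_nonneg _), ofReal_norm]
  rw [e1, e2, ENNReal.ofReal_le_ofReal_iff (integral_nonneg fun p => by positivity)] at h3
  simpa using h3

end MemH10

/-- By the Poincaré inequality, a Cauchy sequence of gradients forces the functions themselves to be
Cauchy. Limits of gradients of test functions are therefore gradients of `H¹₀` functions. -/
theorem exists_memH10_of_tendsto_stripGrad {φ : ℕ → Strip lx ly → ℝ}
    (hφ : ∀ n, IsTestFunction (φ n)) (hG : MemLp G 2 (layerMeasure lx ly))
    (h : Tendsto (fun n => eLpNorm (fun p => stripGrad (φ n) p - G p) 2 (layerMeasure lx ly))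
      atTop (𝓝 0)) : ∃ v, MemH10 v G := by
  have hg : Tendsto (fun n => ((hφ n).memLp_stripGrad 2).toLp (stripGrad (φ n))) atTop
      (𝓝 (hG.toLp G)) :=
    (Lp.tendsto_Lp_iff_tendsto_eLpNorm'' _ (fun n => (hφ n).memLp_stripGrad 2) G hG).2 h
  have hC : CauchySeq fun n => ((hφ n).memLp 2).toLp (φ n) := by
    have hg' := Metric.cauchySeq_iff.1 hg.cauchySeq
    refine Metric.cauchySeq_iff.2 fun ε hε => ?_
    obtain ⟨N, hN⟩ := hg' ε hε
    refine ⟨N, fun m hm n hn => lt_of_le_of_lt ?_ (hN m hm n hn)⟩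
    rw [dist_eq_norm, dist_eq_norm, ← MemLp.toLp_sub, ← MemLp.toLp_sub, Lp.norm_toLp, Lp.norm_toLp]
    refine ENNReal.toReal_mono (((hφ m).memLp_stripGrad 2).sub ((hφ n).memLp_stripGrad 2)).2.ne ?_
    exact ((hφ m).memH10.sub (hφ n).memH10).eLpNorm_le
  obtain ⟨V, hV⟩ := cauchySeq_tendsto_of_complete hC
  refine ⟨V, Lp.memLp V, hG, φ, hφ, ?_, h⟩
  rw [← Lp.toLp_coeFn V (Lp.memLp V)] at hV
  exact (Lp.tendsto_Lp_iff_tendsto_eLpNorm'' φ (fun n => (hφ n).memLp 2) V (Lp.memLp V)).1 hV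

/-- Weak solvability of the Dirichlet problem with right-hand side in divergence form. -/
theorem exists_dirichlet_solution {m : Strip lx ly → E3} (hm : MemLp m 2 (layerMeasure lx ly)) :
    ∃ v G, MemH10 v G ∧ ∀ φ : Strip lx ly → ℝ, IsTestFunction φ →
      ∫ p, inner ℝ (G p) (stripGrad φ p) ∂(layerMeasure lx ly) =
        ∫ p, inner ℝ (m p) (stripGrad φ p) ∂(layerMeasure lx ly) := by
  let S : Submodule ℝ (Lp E3 2 (layerMeasure lx ly)) :=
    { carrier := {f | ∃ (φ : Strip lx ly → ℝ) (hφ : IsTestFunction φ),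
        f = (hφ.memLp_stripGrad 2).toLp (stripGrad φ)}
      zero_mem' := by
        refine ⟨_, IsTestFunction.zero, ?_⟩
        have h0 : stripGrad (fun _ : Strip lx ly => (0 : ℝ)) = 0 := by
          funext p
          exact stripGrad_eq_of_hasDerivAt fun i => hasDerivAt_const _ _
        simp only [h0]
        exact (MemLp.toLp_zero _).symm
      add_mem' := by
        rintro _ _ ⟨φ, hφ, rfl⟩ ⟨ψ, hψ, rfl⟩
        refine ⟨_, hφ.add hψ, ?_⟩
        rw [← MemLp.toLp_add]
        congr 1
        funext p
        exact (hφ.stripGrad_add hψ p).symm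
      smul_mem' := by
        rintro c _ ⟨φ, hφ, rfl⟩
        refine ⟨_, hφ.const_mul c, ?_⟩
        rw [← MemLp.toLp_const_smul]
        congr 1
        funext p
        exact (hφ.stripGrad_const_mul c p).symm }
  have hcl : ∀ f ∈ S.topologicalClosure, ∃ v, MemH10 v f := by
    intro f hf
    obtain ⟨x, hx, hlim⟩ := mem_closure_iff_seq_limit.1 hf
    choose φ hφ hxφ using hx
    refine exists_memH10_of_tendsto_stripGrad hφ (Lp.memLp f) ?_
    refine (Lp.tendsto_Lp_iff_tendsto_eLpNorm'' (fun n => stripGrad (φ n))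
      (fun n => (hφ n).memLp_stripGrad 2) f (Lp.memLp f)).1 ?_
    rw [Lp.toLp_coeFn]
    simpa only [← hxφ] using hlim
  -- The gradient of the solution is the orthogonal projection of `m` onto the closure of the
  -- gradients of test functions; orthogonality of the residual is the weak equation.
  let P := S.topologicalClosure.starProjection (hm.toLp m)
  obtain ⟨v, hv⟩ := hcl P (Submodule.starProjection_apply_mem _ _)
  refine ⟨v, P, hv, fun φ hφ => ?_⟩
  have ho := Submodule.starProjection_inner_eq_zero (K := S.topologicalClosure) (hm.toLp m)
    ((hφ.memLp_stripGrad 2).toLp (stripGrad φ)) (S.le_topologicalClosure ⟨φ, hφ, rfl⟩)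
  rw [inner_sub_left, sub_eq_zero, L2.inner_def, L2.inner_def] at ho
  refine Eq.trans (integral_congr_ae ?_) (ho.symm.trans (integral_congr_ae ?_))
  · filter_upwards [(hφ.memLp_stripGrad 2).coeFn_toLp] with p h2
    rw [h2]
  · filter_upwards [hm.coeFn_toLp, (hφ.memLp_stripGrad 2).coeFn_toLp] with p h1 h2
    rw [h1, h2]

end Sobolev

theorem AbsolutelyContinuousOnInterval.memLp_unitMeasure {τ : ℝ → ℝ}
    (hτ : AbsolutelyContinuousOnInterval τ 0 1) (q : ℝ≥0∞) : MemLp τ q unitMeasure := by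
  have hc : ContinuousOn τ (Icc 0 1) := by simpa using hτ.continuousOn
  obtain ⟨C, hC⟩ := isCompact_Icc.exists_bound_of_continuousOn hc
  exact MemLp.of_bound (hc.aestronglyMeasurable measurableSet_Icc) C (ae_unitMeasure_mem.mono hC)

theorem memLp_single {α : Type*} [MeasurableSpace α] {m : Measure α} {f : α → ℝ} {q : ℝ≥0∞}
    (i : Fin 3) (hf : MemLp f q m) :
    MemLp (fun a => (EuclideanSpace.single i (f a) : E3)) q m := by
  refine hf.of_le (g := f) ?_ (Eventually.of_forall fun a => by simp)
  have : (fun a => (EuclideanSpace.single i (f a) : E3)) =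
      fun a => f a • (EuclideanSpace.single i 1 : E3) := by
    funext a
    ext j
    simp
  rw [this]
  exact hf.1.smul_const _

/-! ### Integration by parts against functions of `z` -/

section IntegrationByParts

variable {lx ly : ℝ} [hlx : Fact (0 < lx)] [hly : Fact (0 < ly)]

theorem MemLp.mul_continuous_layer {f h : Strip lx ly → ℝ} {q : ℝ≥0∞}
    (hf : MemLp f q (layerMeasure lx ly)) (hh : Continuous h) :
    MemLp (fun p => f p * h p) q (layerMeasure lx ly) := by
  obtain ⟨C, hC⟩ := exists_bound_layer hh
  refine hf.of_le_mul (c := C) (hf.1.mul hh.aestronglyMeasurable) ?_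
  filter_upwards [ae_layerMeasure_mem] with p hp
  rw [norm_mul, mul_comm]
  exact mul_le_mul_of_nonneg_right (hC p hp) (norm_nonneg _)

/-- Integration by parts for absolutely continuous functions on each vertical line; the boundary
terms vanish with `F`. -/
theorem IsTestFunction.integral_vertical {τ : ℝ → ℝ} {F : Strip lx ly → ℝ} (hF : IsTestFunction F)
    (hτ : AbsolutelyContinuousOnInterval τ 0 1) (hd : MemLp (deriv τ) 2 unitMeasure) :
    ∫ p, deriv τ p.2.2 * F p ∂(layerMeasure lx ly) +
      ∫ p, τ p.2.2 * stripGrad F p 2 ∂(layerMeasure lx ly) = 0 := by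
  have hG : Continuous fun p => stripGrad F p 2 :=
    (PiLp.continuous_apply 2 (fun _ : Fin 3 => ℝ) 2).comp hF.continuous_stripGrad
  have hi1 : Integrable (fun p => deriv τ p.2.2 * F p) (layerMeasure lx ly) :=
    (MemLp.mul_continuous_layer (memLp_height (by simp) hd) hF.continuous).integrable one_le_two
  have hi2 : Integrable (fun p => τ p.2.2 * stripGrad F p 2) (layerMeasure lx ly) :=
    (MemLp.mul_continuous_layer (memLp_height (by simp) (hτ.memLp_unitMeasure 2)) hG).integrable
      one_le_two
  have hi3 := (measurePreserving_layer (lx := lx) (ly := ly)).integrable_comp_of_integrable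
    (hi1.add hi2)
  rw [← integral_add hi1 hi2, ← measurePreserving_layer.integral_comp measurableEmbedding_layer,
    integral_prod _ (by exact hi3)]
  refine integral_eq_zero_of_ae (Eventually.of_forall fun ⟨x, y⟩ => ?_)
  have hderiv : ∀ t, HasDerivAt (fun s : ℝ => F (x, y, s)) (stripGrad F (x, y, t) 2) t := by
    intro t
    have := hF.hasDerivAt_shift (x, y, 0) 2 t
    simpa [stripMk, stripDir] using this
  have hc : ContDiff ℝ 1 fun s : ℝ => F (x, y, s) := by
    rw [contDiff_one_iff_deriv]
    refine ⟨fun t => (hderiv t).differentiableAt, ?_⟩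
    rw [funext fun t => (hderiv t).deriv]
    exact hG.comp (f := fun s : ℝ => ((x, y, s) : Strip lx ly)) (by fun_prop)
  have hIBP := hτ.integral_deriv_mul_eq_sub hc.contDiffOn.absolutelyContinuousOnInterval
  rw [hF.eq_zero (p := (x, y, 1)) (by simp), hF.eq_zero (p := (x, y, 0)) (by simp),
    ← integral_unitMeasure] at hIBP
  simp only [fun t => (hderiv t).deriv, mul_zero, sub_zero] at hIBP
  exact hIBP

/-- The integral of `g(z) F` does not change when `F` is translated in direction `i`.
Differentiating this constant under the integral sign gives the claim. -/
theorem IsTestFunction.integral_horizontal {g : ℝ → ℝ} {F : Strip lx ly → ℝ}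
    (hF : IsTestFunction F) (hg : MemLp g 2 unitMeasure) {i : Fin 3} (hi : i ≠ 2) :
    ∫ p, g p.2.2 * stripGrad F p i ∂(layerMeasure lx ly) = 0 := by
  have hz : ∀ s : ℝ, (stripMk lx ly (s • stripDir i)).2.2 = 0 := by
    intro s
    fin_cases i <;> simp_all [stripMk, stripDir]
  have hG : Continuous fun p => stripGrad F p i :=
    (PiLp.continuous_apply 2 (fun _ : Fin 3 => ℝ) i).comp hF.continuous_stripGrad
  obtain ⟨C, hC⟩ := exists_bound_layer hG
  have hgm := memLp_height (lx := lx) (ly := ly) (by simp) hg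
  have h0 : ∀ p : Strip lx ly, p + stripMk lx ly ((0 : ℝ) • stripDir i) = p := by
    rintro ⟨x, y, z⟩
    simp [stripMk]
  have key := hasDerivAt_integral_of_dominated_loc_of_deriv_le (μ := layerMeasure lx ly)
    (F := fun (s : ℝ) p => g p.2.2 * F (p + stripMk lx ly (s • stripDir i)))
    (F' := fun (s : ℝ) p => g p.2.2 * stripGrad F (p + stripMk lx ly (s • stripDir i)) i)
    (x₀ := 0) (bound := fun p => ‖g p.2.2‖ * C) (s := univ) univ_mem
    (Eventually.of_forall fun s =>
      (MemLp.mul_continuous_layer hgm (hF.continuous.comp (by fun_prop))).1)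
    ((MemLp.mul_continuous_layer hgm (hF.continuous.comp (by fun_prop))).integrable one_le_two)
    (MemLp.mul_continuous_layer hgm (hG.comp (by fun_prop))).1
    (ae_layerMeasure_mem.mono fun p hp s _ => by
      rw [norm_mul]
      refine mul_le_mul_of_nonneg_left (hC _ ?_) (norm_nonneg _)
      simpa [hz s] using hp)
    ((hgm.integrable one_le_two).norm.mul_const C)
    (Eventually.of_forall fun p s _ => (hF.hasDerivAt_shift p i s).const_mul _)
  have hconst : ∀ s : ℝ,
      ∫ p, g p.2.2 * F (p + stripMk lx ly (s • stripDir i)) ∂(layerMeasure lx ly) =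
        ∫ p, g p.2.2 * F p ∂(layerMeasure lx ly) := by
    intro s
    have h1 := measurePreserving_add_horizontal (hz s)
    have h2 := h1.integral_comp (MeasurableEquiv.addRight _).measurableEmbedding
      (fun p : Strip lx ly => g p.2.2 * F p)
    simpa [hz s] using h2
  have h2 := key.2
  simp only [hconst, h0] at h2
  exact h2.unique (hasDerivAt_const _ _)

theorem IsTestFunction.integral_coord {τ : ℝ → ℝ} {F : Strip lx ly → ℝ} (hF : IsTestFunction F)
    (hτ : AbsolutelyContinuousOnInterval τ 0 1) (hd : MemLp (deriv τ) 2 unitMeasure) (i : Fin 3) :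
    ∫ p, (if i = 2 then deriv τ p.2.2 else 0) * F p ∂(layerMeasure lx ly) +
      ∫ p, τ p.2.2 * stripGrad F p i ∂(layerMeasure lx ly) = 0 := by
  by_cases hi : i = 2
  · subst hi
    simpa using hF.integral_vertical hτ hd
  · simpa [hi] using hF.integral_horizontal (hτ.memLp_unitMeasure 2) hi

theorem MemH10.integral_vertical {τ : ℝ → ℝ} {v : Strip lx ly → ℝ} {G : Strip lx ly → E3}
    (hv : MemH10 v G) (hτ : AbsolutelyContinuousOnInterval τ 0 1)
    (hd : MemLp (deriv τ) 2 unitMeasure) :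
    ∫ p, deriv τ p.2.2 * v p ∂(layerMeasure lx ly) +
      ∫ p, τ p.2.2 * G p 2 ∂(layerMeasure lx ly) = 0 := by
  have hB : MemLp (fun p : Strip lx ly => (EuclideanSpace.single 2 (τ p.2.2) : E3)) 2
      (layerMeasure lx ly) :=
    memLp_single 2 (memLp_height (by simp) (hτ.memLp_unitMeasure 2))
  have := hv.integral_relation (memLp_height (by simp) hd) hB (fun φ hφ => by
    simpa [EuclideanSpace.inner_single_left] using hφ.integral_vertical hτ hd)
  simpa [EuclideanSpace.inner_single_left] using this

/-- This is the weak form of `∫ div(τ ψ u) = 0`. Each component comes from integration by parts for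
the product of two test functions, one of which is then replaced by `u i` through
`MemH10.integral_relation`. Keeping `ψ` a test function makes `τ' ψ` square-integrable, as that
passage to the limit requires. The sum over `i` removes the divergence. -/
theorem IsNoSlipFlow.integral_test {τ : ℝ → ℝ} {u : Fin 3 → Strip lx ly → ℝ}
    {Du : Fin 3 → Strip lx ly → E3} {ψ : Strip lx ly → ℝ} (hu : IsNoSlipFlow u Du)
    (hψ : IsTestFunction ψ) (hτ : AbsolutelyContinuousOnInterval τ 0 1)
    (hd : MemLp (deriv τ) 2 unitMeasure) :
    ∫ p, deriv τ p.2.2 * u 2 p * ψ p ∂(layerMeasure lx ly) +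
      ∫ p, inner ℝ (fluxField u (fun p => τ p.2.2) p) (stripGrad ψ p) ∂(layerMeasure lx ly) = 0 := by
  have hG : ∀ i, Continuous fun p => stripGrad ψ p i := fun i =>
    (PiLp.continuous_apply 2 (fun _ : Fin 3 => ℝ) i).comp hψ.continuous_stripGrad
  have hτm := memLp_height (lx := lx) (ly := ly) (by simp) (hτ.memLp_unitMeasure 2)
  have hdm := memLp_height (lx := lx) (ly := ly) (by simp) hd
  have hA1 : ∀ i : Fin 3, MemLp (fun p : Strip lx ly =>
      (if i = 2 then deriv τ p.2.2 else 0) * ψ p) 2 (layerMeasure lx ly) := by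
    intro i
    by_cases hi : i = 2
    · simpa [hi] using MemLp.mul_continuous_layer hdm hψ.continuous
    · simp [hi]
  have hA2 : ∀ i : Fin 3, MemLp (fun p : Strip lx ly => τ p.2.2 * stripGrad ψ p i) 2
      (layerMeasure lx ly) := fun i => MemLp.mul_continuous_layer hτm (hG i)
  have hB := MemLp.mul_continuous_layer hτm hψ.continuous
  have hcomp : ∀ i : Fin 3,
      ∫ p, ((if i = 2 then deriv τ p.2.2 else 0) * ψ p + τ p.2.2 * stripGrad ψ p i) * u i p
        ∂(layerMeasure lx ly) + ∫ p, (τ p.2.2 * ψ p) * Du i p i ∂(layerMeasure lx ly) = 0 := by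
    intro i
    have := (hu.memH10 i).integral_relation ((hA1 i).add (hA2 i)) (memLp_single i hB) ?_
    · simpa [EuclideanSpace.inner_single_left] using this
    · intro φ hφ
      have h := (hφ.mul hψ).integral_coord hτ hd i
      have hφi : Continuous fun p => stripGrad φ p i :=
        (PiLp.continuous_apply 2 (fun _ : Fin 3 => ℝ) i).comp hφ.continuous_stripGrad
      have e1 := (MemLp.mul_continuous_layer (hA1 i) hφ.continuous).integrable one_le_two
      have e2 := (MemLp.mul_continuous_layer (hA2 i) hφ.continuous).integrable one_le_two
      have e3 := (MemLp.mul_continuous_layer hB hφi).integrable one_le_two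
      refine Eq.trans ?_ h
      simp only [hφ.stripGrad_mul hψ, EuclideanSpace.inner_single_left, conj_trivial,
        Pi.add_apply, add_mul, PiLp.add_apply, PiLp.smul_apply, smul_eq_mul, mul_add]
      rw [integral_add e1 e2, add_assoc, ← integral_add e2 e3]
      congr 1
      · exact integral_congr_ae (Eventually.of_forall fun p => by ring)
      · exact integral_congr_ae (Eventually.of_forall fun p => by ring)
  have i1 : ∀ i : Fin 3, Integrable (fun p =>
      ((if i = 2 then deriv τ p.2.2 else 0) * ψ p + τ p.2.2 * stripGrad ψ p i) * u i p)
      (layerMeasure lx ly) := fun i =>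
    ((hA1 i).add (hA2 i)).integrable_mul (hu.memH10 i).memLp
  have i2 : ∀ i : Fin 3, Integrable (fun p => (τ p.2.2 * ψ p) * Du i p i)
      (layerMeasure lx ly) := fun i =>
    hB.integrable_mul (MemLp.of_le (hu.memH10 i).memLp_grad
      ((PiLp.continuous_apply 2 (fun _ : Fin 3 => ℝ) i).comp_aestronglyMeasurable
        (hu.memH10 i).memLp_grad.1) (Eventually.of_forall fun p => PiLp.norm_apply_le _ _))
  have hdiv : ∑ i : Fin 3, ∫ p, (τ p.2.2 * ψ p) * Du i p i ∂(layerMeasure lx ly) = 0 := by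
    rw [← integral_finsetSum _ fun i _ => i2 i]
    refine integral_eq_zero_of_ae (hu.div_free.mono fun p hp => ?_)
    change ∑ i : Fin 3, τ p.2.2 * ψ p * Du i p i = 0
    rw [← Finset.mul_sum, hp, mul_zero]
  have hsum := Finset.sum_eq_zero fun (i : Fin 3) (_ : i ∈ Finset.univ) => hcomp i
  rw [Finset.sum_add_distrib, hdiv, add_zero, ← integral_finsetSum _ fun i _ => i1 i] at hsum
  have j1 : Integrable (fun p => deriv τ p.2.2 * u 2 p * ψ p) (layerMeasure lx ly) := by
    refine (MemLp.integrable_mul (MemLp.mul_continuous_layer hdm hψ.continuous)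
      (hu.memH10 2).memLp).congr (Eventually.of_forall fun p => ?_)
    simp only [Pi.mul_apply]
    ring
  have j2 : Integrable (fun p => inner ℝ (fluxField u (fun p => τ p.2.2) p) (stripGrad ψ p))
      (layerMeasure lx ly) := by
    refine (integrable_finsetSum Finset.univ fun (i : Fin 3) _ =>
      (hA2 i).integrable_mul (hu.memH10 i).memLp).congr (Eventually.of_forall fun p => ?_)
    simp only [Pi.mul_apply, fluxField, PiLp.inner_apply, RCLike.inner_apply, conj_trivial]
    exact Finset.sum_congr rfl fun i _ => by ring
  rw [← hsum, ← integral_add j1 j2]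
  refine integral_congr_ae (Eventually.of_forall fun p => ?_)
  simp [fluxField, PiLp.inner_apply, Fin.sum_univ_three]
  ring

end IntegrationByParts

theorem MeasureTheory.MemLp.exists_ae_bound {α E : Type*} [MeasurableSpace α]
    [NormedAddCommGroup E] {m : Measure α} {f : α → E} (hf : MemLp f ⊤ m) :
    ∃ C, ∀ᵐ a ∂m, ‖f a‖ ≤ C := by
  refine ⟨(eLpNormEssSup f m).toReal, (ae_le_eLpNormEssSup (f := f)).mono fun a ha => ?_⟩
  have hfin : eLpNormEssSup f m ≠ ⊤ := by
    rw [← eLpNorm_exponent_top]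
    exact hf.2.ne
  rw [← toReal_enorm]
  exact ENNReal.toReal_mono hfin ha

theorem measurable_nnnorm_deriv_height {lx ly : ℝ} (τ : ℝ → ℝ) :
    Measurable fun p : Strip lx ly => ‖deriv τ p.2.2‖₊ :=
  ((measurable_deriv τ).comp measurable_snd.snd).nnnorm

/-! ### The cubic term `w θ τ'` -/

section Trilinear

variable {lx ly : ℝ} [hlx : Fact (0 < lx)] [hly : Fact (0 < ly)]

/-- The layer measure weighted by `|τ'(z)|`. -/
noncomputable def weightedLayer (lx ly : ℝ) [Fact (0 < lx)] [Fact (0 < ly)] (τ : ℝ → ℝ) :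
    Measure (Strip lx ly) :=
  (layerMeasure lx ly).withDensity fun p => (‖deriv τ p.2.2‖₊ : ℝ≥0∞)

/-- The weighted Poincaré inequality with `ρ = |τ'|`; the constant is the square root of the `L¹`
norm of `τ'`. -/
theorem MemH10.exists_eLpNorm_weightedLayer_le {τ : ℝ → ℝ} (hd : MemLp (deriv τ) 2 unitMeasure) :
    ∃ c : ℝ≥0∞, c ≠ ⊤ ∧ ∀ (v : Strip lx ly → ℝ) (G : Strip lx ly → E3), MemH10 v G →
      eLpNorm v 2 (weightedLayer lx ly τ) ≤ c * eLpNorm G 2 (layerMeasure lx ly) := by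
  have hC : ∫⁻ z, (‖deriv τ z‖₊ : ℝ≥0∞) ∂unitMeasure ≠ ⊤ :=
    (hd.integrable one_le_two).2.ne
  refine ⟨(∫⁻ z, (‖deriv τ z‖₊ : ℝ≥0∞) ∂unitMeasure) ^ (1 / 2 : ℝ),
    ENNReal.rpow_ne_top_of_nonneg (by norm_num) hC, fun v G hv => ?_⟩
  refine (ENNReal.pow_le_pow_left_iff two_ne_zero).1 ?_
  rw [mul_pow, ← ENNReal.rpow_natCast (_ ^ (1 / 2 : ℝ)), ← ENNReal.rpow_mul, eLpNorm_two_sq,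
    eLpNorm_two_sq, weightedLayer, lintegral_withDensity_eq_lintegral_mul₀
      (measurable_nnnorm_deriv_height τ).coe_nnreal_ennreal.aemeasurable
      (hv.memLp.1.enorm.pow_const 2)]
  norm_num
  exact hv.weighted_poincare (measurable_deriv τ).nnnorm hC

theorem MemH10.memLp_weightedLayer {τ : ℝ → ℝ} (hd : MemLp (deriv τ) 2 unitMeasure)
    {v : Strip lx ly → ℝ} {G : Strip lx ly → E3} (hv : MemH10 v G) :
    MemLp v 2 (weightedLayer lx ly τ) := by
  obtain ⟨c, hc, h⟩ := MemH10.exists_eLpNorm_weightedLayer_le (lx := lx) (ly := ly) hd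
  exact ⟨hv.memLp.1.mono_ac (withDensity_absolutelyContinuous _ _),
    (h v G hv).trans_lt (ENNReal.mul_lt_top hc.lt_top hv.memLp_grad.2)⟩

theorem memLp_fluxField {u : Fin 3 → Strip lx ly → ℝ} {η : Strip lx ly → ℝ}
    (hu : ∀ i, MemLp (u i) 2 (layerMeasure lx ly)) (hη : MemLp η ⊤ (layerMeasure lx ly)) :
    MemLp (fluxField u η) 2 (layerMeasure lx ly) := by
  have h : fluxField u η = fun p => ∑ i, (EuclideanSpace.single i (u i p * η p) : E3) := by
    funext p
    ext j
    simp [fluxField, Pi.single_apply]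
  rw [h]
  exact memLp_finsetSum _ fun i _ => memLp_single i (hη.mul' (hu i))

theorem memLp_top_height {τ : ℝ → ℝ} (hτ : MemLp τ ⊤ unitMeasure) :
    MemLp (fun p : Strip lx ly => τ p.2.2) ⊤ (layerMeasure lx ly) := by
  obtain ⟨C, hC⟩ := hτ.exists_ae_bound
  exact memLp_top_of_bound (hτ.1.comp_quasiMeasurePreserving quasiMeasurePreserving_height) C
    (quasiMeasurePreserving_height.ae hC)

/-- With `|τ'|` absorbed into the measure, the triple product becomes an `L²` pairing of `sign(τ')
w` with `θ`. The weighted norm is controlled by the gradient norm, so both sides are continuous in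
`θ` and the identity passes from test functions to `H¹₀`. -/
theorem IsNoSlipFlow.integral_background {τ : ℝ → ℝ} {u : Fin 3 → Strip lx ly → ℝ}
    {Du : Fin 3 → Strip lx ly → E3} {θ : Strip lx ly → ℝ} {Dθ : Strip lx ly → E3}
    (hu : IsNoSlipFlow u Du) (hθ : MemH10 θ Dθ) (hτ : AbsolutelyContinuousOnInterval τ 0 1)
    (hd : MemLp (deriv τ) 2 unitMeasure) :
    Integrable (fun p => u 2 p * θ p * deriv τ p.2.2) (layerMeasure lx ly) ∧
      ∫ p, u 2 p * θ p * deriv τ p.2.2 ∂(layerMeasure lx ly) =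
        -∫ p, inner ℝ (fluxField u (fun p => τ p.2.2) p) (Dθ p) ∂(layerMeasure lx ly) := by
  have hm := measurable_nnnorm_deriv_height (lx := lx) (ly := ly) τ
  have hdm : Measurable fun p : Strip lx ly => deriv τ p.2.2 :=
    (measurable_deriv τ).comp measurable_snd.snd
  have hu2 := (hu.memH10 2).memLp_weightedLayer hd
  -- The quotient is the sign of `τ'`, with value `0` where `τ'` vanishes.
  have hg : MemLp (fun p : Strip lx ly => deriv τ p.2.2 / |deriv τ p.2.2| * u 2 p) 2
      (weightedLayer lx ly τ) := by
    refine hu2.of_le ((hdm.div hdm.norm).aestronglyMeasurable.mul hu2.1)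
      (Eventually.of_forall fun p => ?_)
    rw [norm_mul]
    refine mul_le_of_le_one_left (norm_nonneg _) ?_
    rw [norm_div, Real.norm_eq_abs, Real.norm_eq_abs, abs_abs]
    exact div_self_le_one _
  have hpt : ∀ a b d : ℝ, ‖d‖₊ • (d / |d| * a * b) = a * b * d := by
    intro a b d
    change |d| * (d / |d| * a * b) = a * b * d
    by_cases h : d = 0
    · simp [h]
    · have := abs_ne_zero.2 h
      field_simp
  have hw : ∀ f : Strip lx ly → ℝ,
      ∫ p, inner ℝ (deriv τ p.2.2 / |deriv τ p.2.2| * u 2 p) (f p) ∂(weightedLayer lx ly τ) =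
        ∫ p, u 2 p * f p * deriv τ p.2.2 ∂(layerMeasure lx ly) := by
    intro f
    rw [weightedLayer, integral_withDensity_eq_integral_smul hm]
    refine integral_congr_ae (Eventually.of_forall fun p => ?_)
    simp only [RCLike.inner_apply, conj_trivial, mul_comm (f p) (_ * u 2 p)]
    exact hpt _ _ _
  refine ⟨?_, ?_⟩
  · have hi := hg.integrable_mul (hθ.memLp_weightedLayer hd)
    rw [weightedLayer, integrable_withDensity_iff_integrable_smul hm] at hi
    exact hi.congr (Eventually.of_forall fun p => hpt _ _ _)
  · obtain ⟨c, hc, hle⟩ := MemH10.exists_eLpNorm_weightedLayer_le (lx := lx) (ly := ly) hd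
    obtain ⟨φ, hφ, h1, h2⟩ := hθ.approx
    have hlim : Tendsto (fun n => eLpNorm (fun p => φ n p - θ p) 2 (weightedLayer lx ly τ))
        atTop (𝓝 0) := by
      have h3 := ENNReal.Tendsto.const_mul (a := c) h2 (Or.inr hc)
      rw [mul_zero] at h3
      exact tendsto_of_tendsto_of_tendsto_of_le_of_le tendsto_const_nhds h3
        (fun n => zero_le) fun n => hle _ _ ((hφ n).memH10.sub hθ)
    have t1 := tendsto_integral_inner hg (fun n => (hφ n).memH10.memLp_weightedLayer hd)
      (hθ.memLp_weightedLayer hd) hlim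
    have t2 := tendsto_integral_inner
      (memLp_fluxField (fun i => (hu.memH10 i).memLp) (memLp_top_height (hτ.memLp_unitMeasure ⊤)))
      (fun n => (hφ n).memLp_stripGrad 2) hθ.memLp_grad h2
    simp only [hw] at t1
    refine tendsto_nhds_unique t1 (t2.neg.congr fun n => ?_)
    rw [← eq_neg_of_add_eq_zero_left (hu.integral_test (hφ n) hτ hd)]
    refine integral_congr_ae (Eventually.of_forall fun p => ?_)
    ring

end Trilinear

/-! ### Primitives and density of smooth functions on the unit interval -/

theorem MeasureTheory.Integrable.intervalIntegrable_unit {d : ℝ → ℝ}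
    (hd : Integrable d unitMeasure) : IntervalIntegrable d volume 0 1 :=
  (intervalIntegrable_iff_integrableOn_Icc_of_le zero_le_one).2 hd

theorem absolutelyContinuousOnInterval_primitive {d : ℝ → ℝ} (hd : Integrable d unitMeasure)
    (c : ℝ) : AbsolutelyContinuousOnInterval (fun z => c + ∫ t in (0 : ℝ)..z, d t) 0 1 :=
  AbsolutelyContinuousOnInterval.add
    (contDiff_const (c := c)).contDiffOn.absolutelyContinuousOnInterval
    (hd.intervalIntegrable_unit.absolutelyContinuousOnInterval_intervalIntegral (by simp))

theorem deriv_primitive_ae_eq {d : ℝ → ℝ} (hd : Integrable d unitMeasure) (c : ℝ) :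
    deriv (fun z => c + ∫ t in (0 : ℝ)..z, d t) =ᵐ[unitMeasure] d := by
  have h := hd.intervalIntegrable_unit.ae_hasDerivAt_integral
  filter_upwards [ae_restrict_of_ae h, ae_unitMeasure_mem] with z hz hz1
  exact ((hz (by simpa using hz1) 0 (by simp)).const_add c).deriv

theorem AbsolutelyContinuousOnInterval.sub_eq_integral_deriv {τ : ℝ → ℝ}
    (hτ : AbsolutelyContinuousOnInterval τ 0 1) {z : ℝ} (hz : z ∈ Icc (0 : ℝ) 1) :
    τ z - τ 0 = ∫ t in (0 : ℝ)..z, deriv τ t :=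
  (hτ.mono (by
    rw [uIcc_of_le hz.1, uIcc_of_le zero_le_one]
    exact Icc_subset_Icc_right hz.2)).integral_deriv_eq_sub.symm

theorem ae_unitMeasure_mem_Ioo : ∀ᵐ z ∂unitMeasure, z ∈ Ioo (0 : ℝ) 1 := by
  rw [unitMeasure, ← Measure.restrict_congr_set (Ioo_ae_eq_Icc (μ := volume) (a := (0 : ℝ)) (b := 1))]
  exact ae_restrict_mem measurableSet_Ioo

/-- A smooth function supported in `(0,1)` with zero mean has a primitive supported in `(0,1)`. -/
theorem exists_smooth_primitive {k : ℝ → ℝ} (hk : ContDiff ℝ ∞ k) (hc : HasCompactSupport k)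
    (hs : tsupport k ⊆ Ioo 0 1) (h0 : ∫ z, k z ∂unitMeasure = 0) :
    ∃ f : ℝ → ℝ, ContDiff ℝ ∞ f ∧ HasCompactSupport f ∧ tsupport f ⊆ Ioo 0 1 ∧ deriv f = k := by
  rw [integral_unitMeasure] at h0
  have hderiv : ∀ z, HasDerivAt (fun z => ∫ t in (0 : ℝ)..z, k t) (k z) z := fun z =>
    intervalIntegral.integral_hasDerivAt_right (hk.continuous.intervalIntegrable _ _)
      (hk.continuous.stronglyMeasurableAtFilter _ _) hk.continuous.continuousAt
  have hd : deriv (fun z => ∫ t in (0 : ℝ)..z, k t) = k := funext fun z => (hderiv z).deriv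
  obtain ⟨a, b, ha, hb, hab⟩ : ∃ a b : ℝ, 0 < a ∧ b < 1 ∧ tsupport k ⊆ Icc a b := by
    -- The point `1/2` keeps the compact set nonempty when `k = 0`, so that its extrema exist.
    have hK : IsCompact (insert (1 / 2 : ℝ) (tsupport k)) := hc.isCompact.insert _
    have hsub : insert (1 / 2 : ℝ) (tsupport k) ⊆ Ioo 0 1 :=
      insert_subset (by norm_num) hs
    refine ⟨_, _, (hsub (hK.sInf_mem (insert_nonempty _ _))).1,
      (hsub (hK.sSup_mem (insert_nonempty _ _))).2, fun z hz => ?_⟩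
    exact ⟨csInf_le hK.bddBelow (mem_insert_of_mem _ hz), le_csSup hK.bddAbove
      (mem_insert_of_mem _ hz)⟩
  have hkz : ∀ t, t ∉ Icc a b → k t = 0 := fun t ht =>
    image_eq_zero_of_notMem_tsupport fun h => ht (hab h)
  have hsupp : tsupport (fun z => ∫ t in (0 : ℝ)..z, k t) ⊆ Icc a b := by
    refine closure_minimal (fun z hz => ?_) isClosed_Icc
    by_contra hzab
    refine hz ?_
    change ∫ t in (0 : ℝ)..z, k t = 0
    rw [mem_Icc, not_and_or, not_le, not_le] at hzab
    rcases hzab with h | h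
    · rw [intervalIntegral.integral_congr (g := fun _ => (0 : ℝ))]
      · simp
      · intro t ht
        refine hkz t fun h2 => ?_
        have := ht.2.trans_lt (max_lt ha h)
        exact absurd h2.1 (not_le.2 this)
    · rw [← intervalIntegral.integral_add_adjacent_intervals (b := 1)
        (hk.continuous.intervalIntegrable _ _) (hk.continuous.intervalIntegrable _ _), h0, zero_add,
        intervalIntegral.integral_congr (g := fun _ => (0 : ℝ))]
      · simp
      · intro t ht
        refine hkz t fun h2 => ?_
        have := (lt_min hb h).trans_le ht.1
        exact absurd h2.2 (not_le.2 this)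
  refine ⟨fun z => ∫ t in (0 : ℝ)..z, k t, ?_, ?_, fun z hz => ?_, hd⟩
  · rw [contDiff_infty_iff_deriv]
    exact ⟨fun z => (hderiv z).differentiableAt, hd.symm ▸ hk⟩
  · exact isCompact_Icc.of_isClosed_subset (isClosed_tsupport _) hsupp
  · exact ⟨ha.trans_le (hsupp hz).1, (hsupp hz).2.trans_lt hb⟩

/-- The smooth functions supported in `(0,1)`. -/
def smoothUnit : Submodule ℝ (ℝ → ℝ) where
  carrier := {f | ContDiff ℝ ∞ f ∧ HasCompactSupport f ∧ tsupport f ⊆ Ioo 0 1}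
  zero_mem' := ⟨contDiff_const, HasCompactSupport.zero, by rw [tsupport_zero]; exact empty_subset _⟩
  add_mem' := fun hf hg => ⟨hf.1.add hg.1, hf.2.1.add hg.2.1,
    (tsupport_add _ _).trans (union_subset hf.2.2 hg.2.2)⟩
  smul_mem' := fun c f hf => ⟨hf.1.const_smul c, hf.2.1.smul_left (f := fun _ => c),
    (tsupport_smul_subset_right (fun _ => c) f).trans hf.2.2⟩

theorem Continuous.memLp_unitMeasure {f : ℝ → ℝ} (hf : Continuous f) (q : ℝ≥0∞) :
    MemLp f q unitMeasure := by
  obtain ⟨C, hC⟩ := isCompact_Icc.exists_bound_of_continuousOn hf.continuousOn (s := Icc (0 : ℝ) 1)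
  exact MemLp.of_bound hf.aestronglyMeasurable C (ae_unitMeasure_mem.mono hC)

theorem memLp_deriv_smoothUnit {f : ℝ → ℝ} (hf : f ∈ smoothUnit) :
    MemLp (deriv f) 2 unitMeasure :=
  Continuous.memLp_unitMeasure (hf.1.continuous_deriv (by simp)) 2

theorem exists_smoothUnit_integral_eq_one : ∃ b ∈ smoothUnit, ∫ z, b z ∂unitMeasure = 1 := by
  let B : ContDiffBump (1 / 2 : ℝ) := ⟨1 / 8, 1 / 4, by norm_num, by norm_num⟩
  have hs : tsupport (B : ℝ → ℝ) ⊆ Ioo 0 1 := by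
    rw [B.tsupport_eq, Real.closedBall_eq_Icc]
    intro x hx
    have h1 : (1 / 2 - 1 / 4 : ℝ) ≤ x := hx.1
    have h2 : x ≤ (1 / 2 + 1 / 4 : ℝ) := hx.2
    constructor <;> linarith
  have hB : (B : ℝ → ℝ) ∈ smoothUnit := ⟨B.contDiff, B.hasCompactSupport, hs⟩
  have hpos : 0 < ∫ z, B z ∂unitMeasure := by
    have : ∫ z, B z ∂unitMeasure = ∫ z, B z := by
      refine setIntegral_eq_integral_of_forall_compl_eq_zero fun z hz => ?_
      exact image_eq_zero_of_notMem_tsupport fun h => hz (Ioo_subset_Icc_self (hs h))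
    rw [this]
    exact B.integral_pos
  refine ⟨_, smoothUnit.smul_mem (∫ z, B z ∂unitMeasure)⁻¹ hB, ?_⟩
  simp only [Pi.smul_apply, smul_eq_mul]
  rw [integral_const_mul, inv_mul_cancel₀ hpos.ne']

/-- Zero-mean functions in `L²(0,1)` are limits of derivatives of smooth functions supported in
`(0,1)`. -/
theorem exists_smoothUnit_deriv_tendsto {g : ℝ → ℝ} (hg : MemLp g 2 unitMeasure)
    (h0 : ∫ z, g z ∂unitMeasure = 0) : ∃ f : ℕ → ℝ → ℝ, (∀ n, f n ∈ smoothUnit) ∧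
      Tendsto (fun n => eLpNorm (fun z => deriv (f n) z - g z) 2 unitMeasure) atTop (𝓝 0) := by
  let S : Submodule ℝ (Lp ℝ 2 unitMeasure) :=
    { carrier := {F | ∃ (f : ℝ → ℝ) (hf : f ∈ smoothUnit),
        F = (memLp_deriv_smoothUnit hf).toLp (deriv f)}
      zero_mem' := by
        refine ⟨0, smoothUnit.zero_mem, ?_⟩
        have h0 : deriv (0 : ℝ → ℝ) = 0 := by funext z; simp
        simp only [h0]
        exact (MemLp.toLp_zero _).symm
      add_mem' := by
        rintro _ _ ⟨f, hf, rfl⟩ ⟨k, hk, rfl⟩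
        refine ⟨_, smoothUnit.add_mem hf hk, ?_⟩
        rw [← MemLp.toLp_add]
        congr 1
        funext z
        exact (deriv_add (hf.1.differentiable (by simp) z) (hk.1.differentiable (by simp) z)).symm
      smul_mem' := by
        rintro c _ ⟨f, hf, rfl⟩
        refine ⟨_, smoothUnit.smul_mem c hf, ?_⟩
        rw [← MemLp.toLp_const_smul]
        congr 1
        funext z
        exact (deriv_const_smul c (hf.1.differentiable (by simp) z)).symm }
  obtain ⟨b, hb, hb1⟩ := exists_smoothUnit_integral_eq_one
  have hmem : hg.toLp g ∈ S.topologicalClosure := by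
    -- The du Bois-Reymond argument: an `h` orthogonal to all the derivatives is almost everywhere
    -- constant, hence orthogonal to the zero-mean function `g`.
    rw [← Submodule.orthogonal_orthogonal_eq_closure, Submodule.mem_orthogonal]
    intro h hh
    rw [Submodule.mem_orthogonal] at hh
    have hhm := Lp.memLp h
    have hhi : Integrable h unitMeasure := hhm.integrable one_le_two
    have hint : ∀ k ∈ smoothUnit, Integrable (fun z => k z * h z) unitMeasure := fun k hk =>
      (Continuous.memLp_unitMeasure hk.1.continuous 2).integrable_mul hhm
    have hkey : ∀ k ∈ smoothUnit, ∫ z, k z ∂unitMeasure = 0 →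
        ∫ z, k z * h z ∂unitMeasure = 0 := by
      intro k hk hk0
      obtain ⟨f, hf1, hf2, hf3, rfl⟩ := exists_smooth_primitive hk.1 hk.2.1 hk.2.2 hk0
      have := hh _ ⟨f, ⟨hf1, hf2, hf3⟩, rfl⟩
      rw [L2.inner_def] at this
      rw [← this]
      refine integral_congr_ae ?_
      filter_upwards [(memLp_deriv_smoothUnit (f := f) ⟨hf1, hf2, hf3⟩).coeFn_toLp] with z hz
      rw [hz, RCLike.inner_apply, conj_trivial, mul_comm]
    set c := ∫ z, b z * h z ∂unitMeasure with hc
    have hae : ∀ᵐ z ∂unitMeasure, z ∈ Ioo (0 : ℝ) 1 → h z - c = 0 := by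
      refine isOpen_Ioo.ae_eq_zero_of_integral_contDiff_smul_eq_zero
        ((hhi.sub (integrable_const c)).locallyIntegrable.locallyIntegrableOn _) ?_
      intro k hk1 hk2 hk3
      have hk : k ∈ smoothUnit := ⟨hk1, hk2, hk3⟩
      have hki : Integrable k unitMeasure :=
        (Continuous.memLp_unitMeasure hk1.continuous 1).integrable le_rfl
      have hbi : Integrable b unitMeasure :=
        (Continuous.memLp_unitMeasure hb.1.continuous 1).integrable le_rfl
      -- Subtracting `(∫ k) b` gives an arbitrary `k` zero mean, since `b` has integral `1`; the
      -- constant value of `h` is then `∫ b h`.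
      have h1 := hkey _ (smoothUnit.sub_mem hk (smoothUnit.smul_mem (∫ z, k z ∂unitMeasure) hb))
        (by
          simp only [Pi.sub_apply, Pi.smul_apply, smul_eq_mul]
          rw [integral_sub hki (hbi.const_mul _), integral_const_mul, hb1, mul_one, sub_self])
      simp only [Pi.sub_apply, Pi.smul_apply, smul_eq_mul, sub_mul, mul_assoc] at h1
      rw [integral_sub (hint k hk) ((hint b hb).const_mul _), integral_const_mul, ← hc] at h1
      simp only [smul_eq_mul, mul_sub]
      rw [integral_sub (hint k hk) (hki.mul_const c), integral_mul_const, h1]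
    rw [L2.inner_def]
    have : ∫ z, inner ℝ (h z) (hg.toLp g z) ∂unitMeasure = ∫ z, g z * c ∂unitMeasure := by
      refine integral_congr_ae ?_
      filter_upwards [hae, ae_unitMeasure_mem_Ioo, hg.coeFn_toLp] with z h1 h2 h3
      rw [h3, sub_eq_zero.1 (h1 h2), RCLike.inner_apply, conj_trivial]
    rw [this, integral_mul_const, h0, zero_mul]
  obtain ⟨x, hx, hlim⟩ := mem_closure_iff_seq_limit.1 hmem
  choose f hf hxf using hx
  refine ⟨f, hf, ?_⟩
  refine (Lp.tendsto_Lp_iff_tendsto_eLpNorm'' (fun n => deriv (f n))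
    (fun n => memLp_deriv_smoothUnit (hf n)) g hg).1 ?_
  simpa only [← hxf] using hlim

/-! ### Background fields as admissible fields -/

section Background

variable {lx ly : ℝ} [hlx : Fact (0 < lx)] [hly : Fact (0 < ly)]

theorem norm_vertical (a : ℝ) : ‖(!₂[(0 : ℝ), 0, a] : E3)‖ = |a| := by
  simp [EuclideanSpace.norm_eq, Fin.sum_univ_three, Real.sqrt_sq_eq_abs]

/-- The boundary values give `τ'` zero mean, so it is an `L²` limit of derivatives of smooth
functions supported in `(0,1)`. Integrating from `0` shows that the functions themselves converge
uniformly. -/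
theorem memH10_height {τ : ℝ → ℝ} (hτ : AbsolutelyContinuousOnInterval τ 0 1)
    (hd : MemLp (deriv τ) 2 unitMeasure) (h0 : τ 0 = 0) (h1 : τ 1 = 0) :
    MemH10 (fun p : Strip lx ly => τ p.2.2) (fun p => !₂[(0 : ℝ), 0, deriv τ p.2.2]) := by
  obtain ⟨f, hf, hlim⟩ := exists_smoothUnit_deriv_tendsto hd (by
    rw [integral_unitMeasure, hτ.integral_deriv_eq_sub, h0, h1, sub_zero])
  have hdm : ∀ n, MemLp (fun z => deriv (f n) z - deriv τ z) 2 unitMeasure := fun n =>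
    (memLp_deriv_smoothUnit (hf n)).sub hd
  have hfd : ∀ n, Differentiable ℝ (f n) := fun n => (hf n).1.differentiable (by simp)
  have hscale : ∀ {k : ℕ → ℝ → ℝ}, (∀ n, AEStronglyMeasurable (k n) unitMeasure) →
      Tendsto (fun n => eLpNorm (k n) 2 unitMeasure) atTop (𝓝 0) →
      Tendsto (fun n => eLpNorm (fun p => k n p.2.2) 2 (layerMeasure lx ly)) atTop (𝓝 0) := by
    intro k hk hk0
    have := ENNReal.Tendsto.const_mul (a := ENNReal.ofReal (lx * ly) ^ (1 / 2 : ℝ≥0∞).toReal) hk0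
      (Or.inr (ENNReal.rpow_ne_top_of_nonneg (by simp) (by simp)))
    rw [mul_zero] at this
    exact this.congr fun n => (eLpNorm_height (by simp) (hk n)).symm
  have hpt : ∀ n, ∀ᵐ z ∂unitMeasure,
      ‖f n z - τ z‖ₑ ≤ eLpNorm (fun z => deriv (f n) z - deriv τ z) 2 unitMeasure := by
    intro n
    filter_upwards [ae_unitMeasure_mem] with z hz
    have hfn : AbsolutelyContinuousOnInterval (f n) 0 1 :=
      ((hf n).1.of_le (by simp)).contDiffOn.absolutelyContinuousOnInterval
    have hf0 : f n 0 = 0 := image_eq_zero_of_notMem_tsupport fun h => by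
      simpa using (hf n).2.2 h
    have e1 := hfn.sub_eq_integral_deriv hz
    have e2 := hτ.sub_eq_integral_deriv hz
    rw [hf0, sub_zero] at e1
    rw [h0, sub_zero] at e2
    have hsub : uIcc (0 : ℝ) z ⊆ uIcc 0 1 := by
      rw [uIcc_of_le hz.1, uIcc_of_le zero_le_one]
      exact Icc_subset_Icc_right hz.2
    rw [e1, e2, ← intervalIntegral.integral_sub
      (((memLp_deriv_smoothUnit (hf n)).integrable one_le_two).intervalIntegrable_unit.mono_set
        hsub) ((hd.integrable one_le_two).intervalIntegrable_unit.mono_set hsub),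
      intervalIntegral.integral_of_le hz.1]
    refine (enorm_integral_le_lintegral_enorm _).trans ?_
    refine le_trans ?_ (eLpNorm_le_eLpNorm_of_exponent_le (p := 1) one_le_two (hdm n).1)
    rw [eLpNorm_one_eq_lintegral_enorm]
    refine lintegral_mono' (Measure.restrict_mono (fun t ht => ?_) le_rfl) fun t => le_rfl
    exact ⟨ht.1.le, ht.2.trans hz.2⟩
  refine ⟨memLp_height (by simp) (hτ.memLp_unitMeasure 2), ?_, fun n p => f n p.2.2,
    fun n => isTestFunction_of_vertical (hf n).1 (hf n).2.1 (hf n).2.2, ?_, ?_⟩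
  · convert memLp_single 2 (memLp_height (lx := lx) (ly := ly) (by simp) hd) using 2 with p
    ext i
    fin_cases i <;> simp
  · refine hscale (k := fun n z => f n z - τ z)
      (fun n => (hf n).1.continuous.aestronglyMeasurable.sub (hτ.memLp_unitMeasure 2).1) ?_
    refine tendsto_of_tendsto_of_tendsto_of_le_of_le tendsto_const_nhds hlim
      (fun n => zero_le) fun n => ?_
    simpa using eLpNorm_le_of_ae_enorm_bound (p := 2) (hpt n)
  · refine (hscale (fun n => (hdm n).1) hlim).congr fun n => ?_
    refine eLpNorm_congr_norm_ae (Eventually.of_forall fun p => ?_)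
    rw [stripGrad_vertical (hfd n), Real.norm_eq_abs, ← norm_vertical]
    congr 1
    ext i
    fin_cases i <;> simp

theorem IsBackground.memLp_deriv_unit {τ : ℝ → ℝ} (hτ : IsBackground τ) :
    MemLp (deriv τ) 2 unitMeasure := hτ.memLp_deriv

theorem IsBackground.isSymmAdmissible {τ : ℝ → ℝ} (hτ : IsBackground τ) :
    IsSymmAdmissible (fun p : Strip lx ly => τ p.2.2) (fun p => !₂[(0 : ℝ), 0, deriv τ p.2.2]) := by
  refine ⟨?_, memLp_top_height (hτ.absCont.memLp_unitMeasure ⊤)⟩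
  have hl : AbsolutelyContinuousOnInterval (fun z : ℝ => 1 - z) 0 1 :=
    (contDiff_const.sub contDiff_id).contDiffOn.absolutelyContinuousOnInterval
  have hae : deriv (fun z => τ z - (1 - z)) =ᵐ[unitMeasure] fun z => deriv τ z + 1 := by
    have h := hτ.absCont.ae_differentiableAt
    filter_upwards [ae_restrict_of_ae h, ae_unitMeasure_mem] with z hz hz1
    have h2 : HasDerivAt (fun z => τ z - (1 - z)) (deriv τ z - (-1)) z :=
      (hz (by simpa using hz1)).hasDerivAt.sub (by simpa using (hasDerivAt_id z).const_sub 1)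
    rw [h2.deriv, sub_neg_eq_add]
  have h := memH10_height (lx := lx) (ly := ly) (τ := fun z => τ z - (1 - z)) (hτ.absCont.sub hl)
    ((memLp_congr_ae hae).2 (hτ.memLp_deriv_unit.add (memLp_const 1))) (by simp [hτ.at_zero])
    (by simp [hτ.at_one])
  refine h.congr (Eventually.of_forall fun p => rfl) ?_
  filter_upwards [quasiMeasurePreserving_height.ae hae] with p hp
  rw [hp]
  ext i
  fin_cases i <;> simp

end Background

/-! ### Duality between spectral stability and the transport supremum -/

theorem MeasureTheory.MemLp.integrable_inner_of_two {α E : Type*} [MeasurableSpace α]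
    [NormedAddCommGroup E] [InnerProductSpace ℝ E] {m : Measure α} {f g : α → E}
    (hf : MemLp f 2 m) (hg : MemLp g 2 m) : Integrable (fun a => inner ℝ (f a) (g a)) m :=
  (hf.norm.integrable_mul hg.norm).mono' (hf.1.inner hg.1)
    (Eventually.of_forall fun _ => norm_inner_le_norm _ _)

section Transport

variable {lx ly : ℝ} [hlx : Fact (0 < lx)] [hly : Fact (0 < ly)]
  {u : Fin 3 → Strip lx ly → ℝ} {Du : Fin 3 → Strip lx ly → E3}
  {η v θ : Strip lx ly → ℝ} {G Dθ : Strip lx ly → E3}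

theorem average_nonneg_layer {f : Strip lx ly → ℝ} (hf : ∀ p, 0 ≤ f p) :
    0 ≤ ⨍ p, f p ∂(layerMeasure lx ly) := by
  rw [average_layer]
  exact mul_nonneg (inv_nonneg.2 layer_area_pos.le) (integral_nonneg hf)

theorem IsNoSlipFlow.integrable_enstrophy (hu : IsNoSlipFlow u Du) :
    Integrable (fun p => ∑ i, ‖Du i p‖ ^ 2) (layerMeasure lx ly) :=
  integrable_finsetSum _ fun i _ => (hu.memH10 i).memLp_grad.integrable_norm_pow two_ne_zero

theorem backgroundForm_eq {τ : ℝ → ℝ} (hτ : IsBackground τ) (lam : ℝ) (hu : IsNoSlipFlow u Du)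
    (hθ : MemH10 θ Dθ) :
    backgroundForm τ lam u Du θ Dθ = lam / 2 * meanEnstrophy Du +
      1 / 2 * ⨍ p, ‖Dθ p‖ ^ 2 ∂(layerMeasure lx ly) -
      ⨍ p, inner ℝ (fluxField u (fun p => τ p.2.2) p) (Dθ p) ∂(layerMeasure lx ly) := by
  obtain ⟨hi, he⟩ := hu.integral_background hθ hτ.absCont hτ.memLp_deriv_unit
  have h1 := hu.integrable_enstrophy.const_mul (lam / 2)
  have h2 := (hθ.memLp_grad.integrable_norm_pow two_ne_zero).const_mul (1 / 2)
  rw [backgroundForm, meanEnstrophy, average_layer, average_layer, average_layer, average_layer,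
    integral_add (by exact h1.add h2) hi, integral_add h1 h2, integral_const_mul,
    integral_const_mul, he]
  ring

/-- By density, the weak equation holds against all of `H¹₀`. In particular the solution may be
tested with itself. -/
theorem IsInverseLaplacian.integral_inner {m : Strip lx ly → E3}
    (hv : IsInverseLaplacian (divDistribution m) v G) (hm : MemLp m 2 (layerMeasure lx ly))
    (hθ : MemH10 θ Dθ) :
    ∫ p, inner ℝ (G p) (Dθ p) ∂(layerMeasure lx ly) =
      ∫ p, inner ℝ (m p) (Dθ p) ∂(layerMeasure lx ly) := by
  have hG := hv.memH10.memLp_grad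
  have key : ∀ {K : Strip lx ly → E3}, MemLp K 2 (layerMeasure lx ly) →
      ∫ p, inner ℝ (G p - m p) (K p) ∂(layerMeasure lx ly) =
        ∫ p, inner ℝ (G p) (K p) ∂(layerMeasure lx ly) -
          ∫ p, inner ℝ (m p) (K p) ∂(layerMeasure lx ly) := by
    intro K hK
    simp only [inner_sub_left]
    exact integral_sub (hG.integrable_inner_of_two hK) (hm.integrable_inner_of_two hK)
  have h := hθ.integral_relation (A := fun _ => 0) MemLp.zero (hG.sub hm) (fun φ hφ => by
    have := hv.laplacian_eq φ hφ
    rw [divDistribution, neg_inj] at this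
    simp only [zero_mul, integral_zero, zero_add, Pi.sub_apply]
    rw [key (hφ.memLp_stripGrad 2), this, sub_self])
  simp only [zero_mul, integral_zero, zero_add, Pi.sub_apply] at h
  rwa [key hθ.memLp_grad, sub_eq_zero] at h

theorem integral_inner_le {K L : Strip lx ly → E3} (hK : MemLp K 2 (layerMeasure lx ly))
    (hL : MemLp L 2 (layerMeasure lx ly)) :
    ∫ p, inner ℝ (K p) (L p) ∂(layerMeasure lx ly) ≤
      1 / 2 * ∫ p, ‖K p‖ ^ 2 ∂(layerMeasure lx ly) +
        1 / 2 * ∫ p, ‖L p‖ ^ 2 ∂(layerMeasure lx ly) := by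
  have h1 := (hK.integrable_norm_pow two_ne_zero).const_mul (1 / 2)
  have h2 := (hL.integrable_norm_pow two_ne_zero).const_mul (1 / 2)
  rw [← integral_const_mul, ← integral_const_mul, ← integral_add h1 h2]
  refine integral_mono (hK.integrable_inner_of_two hL) (h1.add h2) fun p => ?_
  have := real_inner_le_norm (K p) (L p)
  nlinarith [sq_nonneg (‖K p‖ - ‖L p‖)]

theorem IsNoSlipFlow.memLp_flux (hu : IsNoSlipFlow u Du) (hη : MemLp η ⊤ (layerMeasure lx ly)) :
    MemLp (fluxField u η) 2 (layerMeasure lx ly) :=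
  memLp_fluxField (fun i => (hu.memH10 i).memLp) hη

/-- Take `θ = v = Δ⁻¹ div(u τ)` in the stability condition. Since `∫ (u τ) · ∇v = ∫ |∇v|²`, the form
reduces to `λ/2 - (1/2) ⨍ |∇v|²` for a normalized flow. -/
theorem transportSup_le_of_spectrallyStable {τ : ℝ → ℝ} {lam : ℝ} (hτ : IsBackground τ)
    (hst : SpectrallyStable lx ly τ lam) :
    transportSup (fun p : Strip lx ly => τ p.2.2) ≤ (lam : EReal) := by
  refine sSup_le ?_
  rintro r ⟨u, Du, v, Dv, hu, hE, hv, rfl⟩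
  rw [EReal.coe_le_coe_iff]
  have h := hst u Du v Dv hu hv.memH10
  have hm := hu.memLp_flux (memLp_top_height (hτ.absCont.memLp_unitMeasure ⊤))
  rw [backgroundForm_eq hτ lam hu hv.memH10, hE, average_layer
    (fun p => inner ℝ (fluxField u (fun p => τ p.2.2) p) (Dv p)),
    ← hv.integral_inner hm hv.memH10, ← average_layer] at h
  simp only [real_inner_self_eq_norm_sq] at h
  linarith

theorem symmValueVertical_le_bmValue (Pe : ℝ) :
    symmValueVertical lx ly Pe ≤ bmValue lx ly Pe := by
  refine le_sInf ?_
  rintro r ⟨τ, lam, hτ, hst, rfl⟩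
  refine le_trans (b := ((⨍ p : Strip lx ly, ‖(!₂[(0 : ℝ), 0, deriv τ p.2.2] : E3)‖ ^ 2
      ∂(layerMeasure lx ly) : ℝ) : EReal) +
      ((Pe ^ 2 : ℝ) : EReal) * transportSup (fun p : Strip lx ly => τ p.2.2))
    (sInf_le ⟨_, _, hτ.isSymmAdmissible, ⟨τ, fun p => rfl⟩, rfl⟩) ?_
  rw [EReal.coe_add]
  refine add_le_add (EReal.coe_le_coe_iff.2 (le_of_eq ?_)) ?_
  · simp only [norm_vertical, sq_abs]
    rw [average_layer, integral_height (f := fun z => deriv τ z ^ 2)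
      ((measurable_deriv τ).pow_const 2).aestronglyMeasurable, ← mul_assoc,
      inv_mul_cancel₀ layer_area_pos.ne', one_mul, integral_unitMeasure]
  · rw [mul_comm lam, EReal.coe_mul]
    exact mul_le_mul_of_nonneg_left (transportSup_le_of_spectrallyStable hτ hst)
      (EReal.coe_nonneg.2 (sq_nonneg Pe))

theorem IsNoSlipFlow.const_mul (hu : IsNoSlipFlow u Du) (c : ℝ) :
    IsNoSlipFlow (fun i p => c * u i p) (fun i p => c • Du i p) where
  memH10 i := (hu.memH10 i).const_mul c
  div_free := hu.div_free.mono fun p hp => by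
    simp only [PiLp.smul_apply, smul_eq_mul, ← Finset.mul_sum, hp, mul_zero]

theorem meanEnstrophy_const_smul (Du : Fin 3 → Strip lx ly → E3) (c : ℝ) :
    meanEnstrophy (fun i p => c • Du i p) = c ^ 2 * meanEnstrophy Du := by
  simp only [meanEnstrophy, average_layer, norm_smul, mul_pow, Real.norm_eq_abs, sq_abs,
    ← Finset.mul_sum, integral_const_mul]
  ring

theorem IsNoSlipFlow.comp_add_right (hu : IsNoSlipFlow u Du) {a : Strip lx ly} (ha : a.2.2 = 0) :
    IsNoSlipFlow (fun i p => u i (p + a)) (fun i p => Du i (p + a)) where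
  memH10 i := (hu.memH10 i).comp_add_right ha
  div_free := (measurePreserving_add_horizontal ha).quasiMeasurePreserving.ae hu.div_free

theorem integral_comp_add_horizontal (f : Strip lx ly → ℝ) {a : Strip lx ly} (ha : a.2.2 = 0) :
    ∫ p, f (p + a) ∂(layerMeasure lx ly) = ∫ p, f p ∂(layerMeasure lx ly) :=
  (measurePreserving_add_horizontal ha).integral_comp
    (MeasurableEquiv.addRight a).measurableEmbedding f

theorem meanEnstrophy_nonneg (Du : Fin 3 → Strip lx ly → E3) : 0 ≤ meanEnstrophy Du :=
  average_nonneg_layer fun _ => Finset.sum_nonneg fun _ _ => sq_nonneg _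

theorem meanEnstrophy_eq_one_of_pos (h : 0 < meanEnstrophy Du) :
    meanEnstrophy (fun i p => (√(meanEnstrophy Du))⁻¹ • Du i p) = 1 := by
  rw [meanEnstrophy_const_smul, inv_pow, Real.sq_sqrt h.le, inv_mul_cancel₀ h.ne']

/-- A normalized shear flow `(b(z), 0, 0)`. It shows that the supremum is taken over a nonempty set
and so is not `⊥`. -/
theorem exists_noSlipFlow_meanEnstrophy_eq_one :
    ∃ (u : Fin 3 → Strip lx ly → ℝ) (Du : Fin 3 → Strip lx ly → E3),
      IsNoSlipFlow u Du ∧ meanEnstrophy Du = 1 := by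
  obtain ⟨b, hb, hb1⟩ := exists_smoothUnit_integral_eq_one
  have hφ : IsTestFunction (fun p : Strip lx ly => b p.2.2) :=
    isTestFunction_of_vertical hb.1 hb.2.1 hb.2.2
  have hgrad := stripGrad_vertical (lx := lx) (ly := ly) (hb.1.differentiable (by simp))
  have h0 : stripGrad (fun _ : Strip lx ly => (0 : ℝ)) = 0 := by
    funext p
    exact stripGrad_eq_of_hasDerivAt fun i => hasDerivAt_const _ _
  let u : Fin 3 → Strip lx ly → ℝ := ![fun p => b p.2.2, fun _ => 0, fun _ => 0]
  have hu : IsNoSlipFlow u (fun i => stripGrad (u i)) := by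
    refine ⟨fun i => ?_, Eventually.of_forall fun p => ?_⟩
    · fin_cases i
      · exact hφ.memH10
      · exact IsTestFunction.zero.memH10
      · exact IsTestFunction.zero.memH10
    · simp [u, Fin.sum_univ_three, h0, hgrad]
  -- Zero enstrophy would force `b = 0` almost everywhere by Poincaré, against `∫ b = 1`.
  have hpos : 0 < meanEnstrophy fun i => stripGrad (u i) := by
    refine lt_of_le_of_ne (meanEnstrophy_nonneg _) fun h => ?_
    have hE : ∫ p, ‖stripGrad (fun p : Strip lx ly => b p.2.2) p‖ ^ 2 ∂(layerMeasure lx ly) = 0 := by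
      have : (lx * ly)⁻¹ *
          ∫ p, ‖stripGrad (fun p : Strip lx ly => b p.2.2) p‖ ^ 2 ∂(layerMeasure lx ly) = 0 := by
        rw [← average_layer, h, meanEnstrophy]
        simp [u, Fin.sum_univ_three, h0]
      exact (mul_eq_zero.1 this).resolve_left (inv_ne_zero layer_area_pos.ne')
    have hle := hφ.memH10.integral_sq_le
    rw [hE] at hle
    have hsq := (integral_eq_zero_iff_of_nonneg (fun p => sq_nonneg _)
      (hφ.memLp 2).integrable_sq).1 (le_antisymm hle (integral_nonneg fun p => sq_nonneg _))
    have hzero : ∫ p : Strip lx ly, b p.2.2 ∂(layerMeasure lx ly) = 0 :=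
      integral_eq_zero_of_ae (hsq.mono fun p hp => by simpa using hp)
    rw [integral_height hb.1.continuous.aestronglyMeasurable, hb1, mul_one] at hzero
    exact layer_area_pos.ne' hzero
  exact ⟨_, _, hu.const_mul _, meanEnstrophy_eq_one_of_pos hpos⟩

theorem exists_inverseLaplacian_divDistribution {m : Strip lx ly → E3}
    (hm : MemLp m 2 (layerMeasure lx ly)) :
    ∃ v G, IsInverseLaplacian (divDistribution m) v G := by
  obtain ⟨v, G, hv, h⟩ := exists_dirichlet_solution hm
  exact ⟨v, G, hv, fun φ hφ => by rw [divDistribution, h φ hφ]⟩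

/-- The chain `‖∇v‖ ≤ ‖u η‖ ≤ C ‖u‖ ≤ C ‖∇u‖` in `L²`: test the equation with `v`, bound `η`, and
apply Poincaré. -/
theorem average_norm_sq_inverseLaplacian_le {C : ℝ} (hu : IsNoSlipFlow u Du)
    (hη : MemLp η ⊤ (layerMeasure lx ly)) (hC : ∀ᵐ p ∂(layerMeasure lx ly), ‖η p‖ ≤ C)
    (hv : IsInverseLaplacian (divDistribution (fluxField u η)) v G) :
    ⨍ p, ‖G p‖ ^ 2 ∂(layerMeasure lx ly) ≤ C ^ 2 * meanEnstrophy Du := by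
  have hm := hu.memLp_flux hη
  have hG := hv.memH10.memLp_grad
  have h1 := integral_inner_le hm hG
  rw [← hv.integral_inner hm hv.memH10] at h1
  simp only [real_inner_self_eq_norm_sq] at h1
  have hi : ∀ i, Integrable (fun p => u i p ^ 2) (layerMeasure lx ly) := fun i =>
    (hu.memH10 i).memLp.integrable_sq
  have h2 : ∫ p, ‖fluxField u η p‖ ^ 2 ∂(layerMeasure lx ly) ≤
      ∫ p, C ^ 2 * ∑ i, u i p ^ 2 ∂(layerMeasure lx ly) := by
    refine integral_mono_ae (hm.integrable_norm_pow two_ne_zero)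
      ((integrable_finsetSum _ fun i _ => hi i).const_mul _) ?_
    filter_upwards [hC] with p hp
    rw [EuclideanSpace.norm_sq_eq, Finset.mul_sum]
    refine Finset.sum_le_sum fun i _ => ?_
    simp only [fluxField, norm_mul, mul_pow, Real.norm_eq_abs, sq_abs]
    rw [mul_comm]
    refine mul_le_mul_of_nonneg_right ?_ (sq_nonneg _)
    rw [← sq_abs]
    exact pow_le_pow_left₀ (abs_nonneg _) hp 2
  have h3 : ∫ p, C ^ 2 * ∑ i, u i p ^ 2 ∂(layerMeasure lx ly) ≤
      C ^ 2 * ∫ p, ∑ i, ‖Du i p‖ ^ 2 ∂(layerMeasure lx ly) := by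
    rw [integral_const_mul, integral_finsetSum _ fun i _ => hi i, integral_finsetSum _ fun i _ =>
      (hu.memH10 i).memLp_grad.integrable_norm_pow two_ne_zero]
    exact mul_le_mul_of_nonneg_left (Finset.sum_le_sum fun i _ => (hu.memH10 i).integral_sq_le)
      (sq_nonneg C)
  rw [meanEnstrophy, average_layer, average_layer, mul_left_comm]
  exact mul_le_mul_of_nonneg_left (by linarith) (inv_nonneg.2 layer_area_pos.le)

/-- Finiteness is what allows the supremum to serve as a real multiplier `λ`. -/
theorem exists_transportSup_eq_coe (hη : MemLp η ⊤ (layerMeasure lx ly)) :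
    ∃ m : ℝ, transportSup η = (m : EReal) := by
  obtain ⟨C, hC⟩ := hη.exists_ae_bound
  obtain ⟨u, Du, hu, hE⟩ := exists_noSlipFlow_meanEnstrophy_eq_one (lx := lx) (ly := ly)
  obtain ⟨v, G, hv⟩ := exists_inverseLaplacian_divDistribution (hu.memLp_flux hη)
  have hlow : ((⨍ p, ‖G p‖ ^ 2 ∂(layerMeasure lx ly) : ℝ) : EReal) ≤ transportSup η :=
    le_sSup ⟨u, Du, v, G, hu, hE, hv, rfl⟩
  have hup : transportSup η ≤ ((C ^ 2 : ℝ) : EReal) := by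
    refine sSup_le ?_
    rintro r ⟨u, Du, v, G, hu, hE, hv, rfl⟩
    have := average_norm_sq_inverseLaplacian_le hu hη hC hv
    rw [hE, mul_one] at this
    exact EReal.coe_le_coe_iff.2 this
  refine ⟨(transportSup η).toReal, (EReal.coe_toReal ?_ ?_).symm⟩
  · exact ne_top_of_le_ne_top (EReal.coe_ne_top _) hup
  · exact ne_bot_of_le_ne_bot (EReal.coe_ne_bot _) hlow

/-- With `v = Δ⁻¹ div(u η)`, the left side equals `⨍ ∇v · ∇θ`. Young's inequality and the bound on
`⨍ |∇v|²`, homogeneous in `u`, finish. The resulting inequality is linear in `η`, unlike the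
supremum, and can be averaged. -/
theorem average_inner_flux_le {m : ℝ} (hη : MemLp η ⊤ (layerMeasure lx ly))
    (hm : transportSup η = (m : EReal)) (hu : IsNoSlipFlow u Du) (hθ : MemH10 θ Dθ) :
    ⨍ p, inner ℝ (fluxField u η p) (Dθ p) ∂(layerMeasure lx ly) ≤
      m / 2 * meanEnstrophy Du + 1 / 2 * ⨍ p, ‖Dθ p‖ ^ 2 ∂(layerMeasure lx ly) := by
  have hflux := hu.memLp_flux hη
  obtain ⟨v, G, hv⟩ := exists_inverseLaplacian_divDistribution hflux
  have hG : ⨍ p, ‖G p‖ ^ 2 ∂(layerMeasure lx ly) ≤ m * meanEnstrophy Du := by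
    -- A flow of zero enstrophy cannot be normalized; there the crude `L^∞` bound on `η` already
    -- gives `∇v = 0` in `L²`.
    rcases (meanEnstrophy_nonneg Du).eq_or_lt with h0 | hpos
    · obtain ⟨C, hC⟩ := hη.exists_ae_bound
      have := average_norm_sq_inverseLaplacian_le hu hη hC hv
      rwa [← h0, mul_zero] at this ⊢
    · set c := (√(meanEnstrophy Du))⁻¹ with hc
      have hcv : IsInverseLaplacian (divDistribution (fluxField (fun i p => c * u i p) η))
          (fun p => c * v p) (fun p => c • G p) := by
        refine ⟨hv.memH10.const_mul c, fun φ hφ => ?_⟩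
        have h := hv.laplacian_eq φ hφ
        have hf : ∀ p, fluxField (fun i p => c * u i p) η p = c • fluxField u η p := by
          intro p
          ext i
          simp [fluxField, mul_assoc]
        simp only [divDistribution, hf, real_inner_smul_left, integral_const_mul] at h ⊢
        rw [← mul_neg, h, mul_neg]
      have hle : ((⨍ p, ‖c • G p‖ ^ 2 ∂(layerMeasure lx ly) : ℝ) : EReal) ≤ transportSup η :=
        le_sSup ⟨_, _, _, _, hu.const_mul c, meanEnstrophy_eq_one_of_pos hpos, hcv, rfl⟩
      rw [hm, EReal.coe_le_coe_iff] at hle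
      simp only [average_layer, norm_smul, mul_pow, Real.norm_eq_abs, sq_abs,
        integral_const_mul] at hle
      rw [mul_left_comm, ← average_layer, hc, inv_pow, Real.sq_sqrt hpos.le,
        inv_mul_le_iff₀ hpos] at hle
      rwa [mul_comm]
  have h1 := integral_inner_le hv.memH10.memLp_grad hθ.memLp_grad
  rw [hv.integral_inner hflux hθ] at h1
  have h2 := mul_le_mul_of_nonneg_left h1 (inv_nonneg.2 (layer_area_pos (lx := lx) (ly := ly)).le)
  rw [mul_add, mul_left_comm, mul_left_comm _ (1 / 2 : ℝ), ← average_layer, ← average_layer,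
    ← average_layer] at h2
  linarith

end Transport

/-! ### Horizontal means -/

section HorizontalMean

variable {lx ly : ℝ} [hlx : Fact (0 < lx)] [hly : Fact (0 < ly)]

/-- The mean of `f` over the horizontal torus at height `z`. -/
noncomputable def horizontalMean (f : Strip lx ly → ℝ) (z : ℝ) : ℝ :=
  (lx * ly)⁻¹ * ∫ a : AddCircle lx × AddCircle ly, f (a.1, a.2, z)

theorem MeasureTheory.Integrable.comp_layer {f : Strip lx ly → ℝ}
    (hf : Integrable f (layerMeasure lx ly)) :
    Integrable (fun q : (AddCircle lx × AddCircle ly) × ℝ => f (q.1.1, q.1.2, q.2))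
      ((volume : Measure (AddCircle lx × AddCircle ly)).prod unitMeasure) :=
  measurePreserving_layer.integrable_comp_of_integrable hf

theorem MeasureTheory.Integrable.horizontalMean {f : Strip lx ly → ℝ}
    (hf : Integrable f (layerMeasure lx ly)) : Integrable (horizontalMean f) unitMeasure :=
  hf.comp_layer.integral_prod_right.const_mul _

theorem MeasureTheory.Integrable.ae_integrable_slice {f : Strip lx ly → ℝ}
    (hf : Integrable f (layerMeasure lx ly)) : ∀ᵐ z ∂unitMeasure,
      Integrable (fun a : AddCircle lx × AddCircle ly => f (a.1, a.2, z)) volume :=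
  hf.comp_layer.prod_left_ae

theorem integral_eq_integral_horizontalMean {f : Strip lx ly → ℝ}
    (hf : Integrable f (layerMeasure lx ly)) :
    ∫ p, f p ∂(layerMeasure lx ly) = lx * ly * ∫ z, horizontalMean f z ∂unitMeasure := by
  rw [← measurePreserving_layer.integral_comp measurableEmbedding_layer,
    integral_prod_symm _ hf.comp_layer, ← integral_const_mul]
  refine integral_congr_ae (Eventually.of_forall fun z => ?_)
  simp only [horizontalMean]
  rw [mul_inv_cancel_left₀ layer_area_pos.ne']

theorem horizontalMean_height_mul (g : ℝ → ℝ) (f : Strip lx ly → ℝ) (z : ℝ) :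
    horizontalMean (fun p => g p.2.2 * f p) z = g z * horizontalMean f z := by
  simp only [horizontalMean, integral_const_mul]
  ring

theorem horizontalMean_add {f g : Strip lx ly → ℝ} (hf : Integrable f (layerMeasure lx ly))
    (hg : Integrable g (layerMeasure lx ly)) :
    horizontalMean (fun p => f p + g p) =ᵐ[unitMeasure]
      fun z => horizontalMean f z + horizontalMean g z := by
  filter_upwards [hf.ae_integrable_slice, hg.ae_integrable_slice] with z h1 h2
  simp only [horizontalMean]
  rw [integral_add h1 h2, mul_add]

theorem volume_real_torus :
    (volume : Measure (AddCircle lx × AddCircle ly)).real univ = lx * ly := by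
  rw [measureReal_def, volume_torus, ENNReal.toReal_ofReal layer_area_pos.le]

instance : IsFiniteMeasure (volume : Measure (AddCircle lx × AddCircle ly)) :=
  ⟨by rw [volume_torus]; exact ENNReal.ofReal_lt_top⟩

theorem horizontalMean_height (g : ℝ → ℝ) (z : ℝ) :
    horizontalMean (fun p : Strip lx ly => g p.2.2) z = g z := by
  simp only [horizontalMean, integral_const, volume_real_torus, smul_eq_mul]
  rw [inv_mul_cancel_left₀ layer_area_pos.ne']

/-- The variance over almost every horizontal slice is nonnegative. -/
theorem horizontalMean_sq_le {f : Strip lx ly → ℝ} (hf : MemLp f 2 (layerMeasure lx ly)) :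
    ∀ᵐ z ∂unitMeasure, horizontalMean f z ^ 2 ≤ horizontalMean (fun p => f p ^ 2) z := by
  filter_upwards [(hf.integrable one_le_two).ae_integrable_slice,
    hf.integrable_sq.ae_integrable_slice] with z h1 h2
  have hA := layer_area_pos (lx := lx) (ly := ly)
  set m := horizontalMean f z with hm
  have hI : ∫ a : AddCircle lx × AddCircle ly, f (a.1, a.2, z) = lx * ly * m := by
    rw [hm, horizontalMean, mul_inv_cancel_left₀ hA.ne']
  have hnn : 0 ≤ ∫ a : AddCircle lx × AddCircle ly, (f (a.1, a.2, z) - m) ^ 2 :=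
    integral_nonneg fun a => sq_nonneg _
  have hexp : ∫ a : AddCircle lx × AddCircle ly, (f (a.1, a.2, z) - m) ^ 2 =
      (∫ a : AddCircle lx × AddCircle ly, f (a.1, a.2, z) ^ 2) - lx * ly * m ^ 2 := by
    have : ∀ a : AddCircle lx × AddCircle ly, (f (a.1, a.2, z) - m) ^ 2 =
        f (a.1, a.2, z) ^ 2 - 2 * m * f (a.1, a.2, z) + m ^ 2 := fun a => by ring
    simp only [this]
    rw [integral_add (by exact h2.sub (h1.const_mul _)) (integrable_const _),
      integral_sub h2 (h1.const_mul _), integral_const_mul, hI, integral_const, volume_real_torus,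
      smul_eq_mul]
    ring
  rw [hexp, sub_nonneg] at hnn
  rw [horizontalMean, inv_mul_eq_div, le_div_iff₀ hA]
  linarith

theorem MeasureTheory.MemLp.horizontalMean {f : Strip lx ly → ℝ}
    (hf : MemLp f 2 (layerMeasure lx ly)) : MemLp (horizontalMean f) 2 unitMeasure := by
  have hm := (hf.integrable one_le_two).horizontalMean.1
  refine (memLp_two_iff_integrable_sq hm).2 (hf.integrable_sq.horizontalMean.mono' (hm.pow 2) ?_)
  filter_upwards [horizontalMean_sq_le hf] with z hz
  rwa [Real.norm_of_nonneg (sq_nonneg _)]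

theorem integral_horizontalMean_sq_le {f : Strip lx ly → ℝ} (hf : MemLp f 2 (layerMeasure lx ly)) :
    ∫ z, horizontalMean f z ^ 2 ∂unitMeasure ≤ ⨍ p, f p ^ 2 ∂(layerMeasure lx ly) := by
  rw [average_layer, integral_eq_integral_horizontalMean hf.integrable_sq,
    inv_mul_cancel_left₀ layer_area_pos.ne']
  exact integral_mono_ae hf.horizontalMean.integrable_sq hf.integrable_sq.horizontalMean
    (horizontalMean_sq_le hf)

theorem memLp_apply {G : Strip lx ly → E3} (hG : MemLp G 2 (layerMeasure lx ly)) (i : Fin 3) :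
    MemLp (fun p => G p i) 2 (layerMeasure lx ly) :=
  hG.of_le ((PiLp.continuous_apply 2 (fun _ : Fin 3 => ℝ) i).comp_aestronglyMeasurable hG.1)
    (Eventually.of_forall fun _ => PiLp.norm_apply_le _ _)

/-- The horizontal mean of an `H¹₀` function is the primitive of the mean of its vertical
derivative. -/
theorem MemH10.horizontalMean_eq {v : Strip lx ly → ℝ} {G : Strip lx ly → E3} (hv : MemH10 v G) :
    ∫ z in (0 : ℝ)..1, horizontalMean (fun p => G p 2) z = 0 ∧
      horizontalMean v =ᵐ[unitMeasure]
        fun z => ∫ t in (0 : ℝ)..z, horizontalMean (fun p => G p 2) t := by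
  have hA := (layer_area_pos (lx := lx) (ly := ly)).ne'
  have hG2 := memLp_apply hv.memLp_grad 2
  have hg := hG2.horizontalMean
  have hgi := hg.integrable one_le_two
  have hvm := hv.memLp.horizontalMean
  set g := horizontalMean (fun p => G p 2) with hgdef
  have hIBP : ∀ R : ℝ → ℝ, AbsolutelyContinuousOnInterval R 0 1 → MemLp (deriv R) 2 unitMeasure →
      ∫ z, deriv R z * horizontalMean v z ∂unitMeasure + ∫ z, R z * g z ∂unitMeasure = 0 := by
    intro R hR hdR
    have h := hv.integral_vertical hR hdR
    rw [integral_eq_integral_horizontalMean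
        (by exact (memLp_height (by simp) hdR).integrable_mul hv.memLp),
      integral_eq_integral_horizontalMean
        (by exact (memLp_height (by simp) (hR.memLp_unitMeasure 2)).integrable_mul hG2),
      ← mul_add] at h
    simp only [horizontalMean_height_mul] at h
    exact (mul_eq_zero.1 h).resolve_left hA
  have h0 : ∫ z in (0 : ℝ)..1, g z = 0 := by
    have := hIBP (fun _ => 1) contDiff_const.contDiffOn.absolutelyContinuousOnInterval
      (by simp)
    simpa [integral_unitMeasure] using this
  refine ⟨h0, ?_⟩
  have hD : AbsolutelyContinuousOnInterval (fun z => ∫ t in (0 : ℝ)..z, g t) 0 1 := by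
    simpa using absolutelyContinuousOnInterval_primitive hgi 0
  have hDd : deriv (fun z => ∫ t in (0 : ℝ)..z, g t) =ᵐ[unitMeasure] g := by
    simpa using deriv_primitive_ae_eq hgi 0
  set D := fun z => ∫ t in (0 : ℝ)..z, g t with hDdef
  have hDm := hD.memLp_unitMeasure 2
  set ρ := fun z => horizontalMean v z - D z with hρdef
  have hρ : MemLp ρ 2 unitMeasure := hvm.sub hDm
  have hρi := hρ.integrable one_le_two
  -- The primitive `R` of the discrepancy `ρ` is the decisive test function: integrating by parts
  -- against both `horizontalMean v` and `D` yields `∫ ρ² = 0`.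
  have hR : AbsolutelyContinuousOnInterval (fun z => ∫ t in (0 : ℝ)..z, ρ t) 0 1 := by
    simpa using absolutelyContinuousOnInterval_primitive hρi 0
  have hRd : deriv (fun z => ∫ t in (0 : ℝ)..z, ρ t) =ᵐ[unitMeasure] ρ := by
    simpa using deriv_primitive_ae_eq hρi 0
  set R := fun z => ∫ t in (0 : ℝ)..z, ρ t with hRdef
  have e1 := hIBP R hR ((memLp_congr_ae hRd).2 hρ)
  have e2 := hR.integral_deriv_mul_eq_sub hD
  have hD0 : D 0 = 0 := by simp [hDdef]
  have hD1 : D 1 = 0 := h0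
  rw [hD0, hD1, mul_zero, mul_zero, sub_zero, ← integral_unitMeasure] at e2
  have e3 : ∫ z, deriv R z * D z + R z * deriv D z ∂unitMeasure =
      ∫ z, ρ z * D z ∂unitMeasure + ∫ z, R z * g z ∂unitMeasure := by
    rw [← integral_add (by exact hρ.integrable_mul hDm)
      (by exact (hR.memLp_unitMeasure 2).integrable_mul hg)]
    refine integral_congr_ae ?_
    filter_upwards [hRd, hDd] with z h1 h2
    rw [h1, h2]
  have e4 : ∫ z, deriv R z * horizontalMean v z ∂unitMeasure =
      ∫ z, ρ z * horizontalMean v z ∂unitMeasure := by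
    refine integral_congr_ae ?_
    filter_upwards [hRd] with z h1
    rw [h1]
  have e5 : ∫ z, ρ z ^ 2 ∂unitMeasure = 0 := by
    have : ∀ z, ρ z ^ 2 = ρ z * horizontalMean v z - ρ z * D z := fun z => by
      simp only [hρdef]; ring
    simp only [this]
    rw [integral_sub (by exact hρ.integrable_mul hvm) (by exact hρ.integrable_mul hDm)]
    linarith
  have e6 := (integral_eq_zero_iff_of_nonneg (fun z => sq_nonneg _) hρ.integrable_sq).1 e5
  filter_upwards [e6] with z hz
  have : ρ z = 0 := by simpa using hz
  exact sub_eq_zero.1 this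

/-- Averaging a product over horizontal translations of one factor. -/
theorem integral_horizontalMean_mul {η F : Strip lx ly → ℝ} {C : ℝ} (hη : Measurable η)
    (hC : ∀ p, ‖η p‖ ≤ C) (hF : Integrable F (layerMeasure lx ly)) :
    Integrable (fun a : AddCircle lx × AddCircle ly =>
      ∫ p, η (p + (a.1, a.2, 0)) * F p ∂(layerMeasure lx ly)) volume ∧
    ∫ a : AddCircle lx × AddCircle ly, ∫ p, η (p + (a.1, a.2, 0)) * F p ∂(layerMeasure lx ly) =
      lx * ly * ∫ p, horizontalMean η p.2.2 * F p ∂(layerMeasure lx ly) := by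
  have hmeas : Measurable fun q : (AddCircle lx × AddCircle ly) × Strip lx ly =>
      η (q.2 + (q.1.1, q.1.2, 0)) := hη.comp (by fun_prop)
  have hint : Integrable (fun q : (AddCircle lx × AddCircle ly) × Strip lx ly =>
      η (q.2 + (q.1.1, q.1.2, 0)) * F q.2)
      ((volume : Measure (AddCircle lx × AddCircle ly)).prod (layerMeasure lx ly)) :=
    (hF.comp_snd _).bdd_mul hmeas.aestronglyMeasurable (Eventually.of_forall fun q => hC _)
  refine ⟨hint.integral_prod_left, ?_⟩
  rw [integral_integral_swap hint, ← integral_const_mul]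
  refine integral_congr_ae (Eventually.of_forall fun ⟨x, y, z⟩ => ?_)
  simp only [integral_mul_const]
  rw [← mul_assoc, horizontalMean, mul_inv_cancel_left₀ layer_area_pos.ne']
  congr 1
  have h := ((measurePreserving_add_left (volume : Measure (AddCircle lx)) x).prod
    (measurePreserving_add_left (volume : Measure (AddCircle ly)) y)).integral_comp
    ((MeasurableEquiv.addLeft x).prodCongr (MeasurableEquiv.addLeft y)).measurableEmbedding
    (fun a : AddCircle lx × AddCircle ly => η (a.1, a.2, z))
  rw [← Measure.volume_eq_prod] at h
  simpa using h

theorem horizontalMean_congr {f g : Strip lx ly → ℝ} (h : f =ᵐ[layerMeasure lx ly] g) :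
    horizontalMean f =ᵐ[unitMeasure] horizontalMean g := by
  have h1 : ∀ᵐ q ∂((volume : Measure (AddCircle lx × AddCircle ly)).prod unitMeasure),
      f (q.1.1, q.1.2, q.2) = g (q.1.1, q.1.2, q.2) :=
    measurePreserving_layer.quasiMeasurePreserving.ae h
  have h2 := (Measure.measurePreserving_swap (μ := unitMeasure)
    (ν := (volume : Measure (AddCircle lx × AddCircle ly)))).quasiMeasurePreserving.ae h1
  filter_upwards [Measure.ae_ae_of_ae_prod h2] with z hz
  exact congrArg _ (integral_congr_ae hz)

/-- Clipping a measurable representative at `±|C|`. A bound at every point makes `(a, p) ↦ η'(p + a)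
F(p)` integrable on the product, as Fubini requires. -/
theorem MeasureTheory.MemLp.exists_measurable_bounded {η : Strip lx ly → ℝ}
    (hη : MemLp η ⊤ (layerMeasure lx ly)) : ∃ (η' : Strip lx ly → ℝ) (C : ℝ),
      Measurable η' ∧ (∀ p, ‖η' p‖ ≤ C) ∧ η =ᵐ[layerMeasure lx ly] η' := by
  obtain ⟨C, hC⟩ := hη.exists_ae_bound
  have hm := hη.1.stronglyMeasurable_mk.measurable
  refine ⟨fun p => max (-|C|) (min |C| (hη.1.mk η p)), |C|,
    measurable_const.max (measurable_const.min hm), fun p => ?_, ?_⟩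
  · rw [Real.norm_eq_abs, abs_le]
    exact ⟨le_max_left _ _, max_le (by linarith [abs_nonneg C]) (min_le_left _ _)⟩
  · filter_upwards [hC, hη.1.ae_eq_mk] with p h1 h2
    have h3 := abs_le.1 (h1.trans (le_abs_self C))
    rw [← h2, min_eq_right h3.2, max_eq_right h3.1]

end HorizontalMean

theorem inner_fluxField {lx ly : ℝ} (u : Fin 3 → Strip lx ly → ℝ) (η : Strip lx ly → ℝ) (K : Strip lx ly → E3)
    (p : Strip lx ly) :
    inner ℝ (fluxField u η p) (K p) = η p * ∑ i, u i p * K p i := by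
  simp only [fluxField, PiLp.inner_apply, RCLike.inner_apply, conj_trivial, Finset.mul_sum]
  exact Finset.sum_congr rfl fun i _ => by ring

/-! ### Averaging an admissible field over horizontal translations -/

section Symmetrization

variable {lx ly : ℝ} [hlx : Fact (0 < lx)] [hly : Fact (0 < ly)]
  {u : Fin 3 → Strip lx ly → ℝ} {Du : Fin 3 → Strip lx ly → E3}
  {η θ : Strip lx ly → ℝ} {Dη Dθ : Strip lx ly → E3}

/-- The bound of `average_inner_flux_le` holds with the same right side for every horizontal
translate of `η`. By linearity in `η` it survives averaging over the torus. -/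
theorem average_inner_flux_horizontalMean_le {τ : ℝ → ℝ} {m : ℝ}
    (hη : MemLp η ⊤ (layerMeasure lx ly)) (hm : transportSup η = (m : EReal))
    (hτ : τ =ᵐ[unitMeasure] horizontalMean η) (hu : IsNoSlipFlow u Du) (hθ : MemH10 θ Dθ) :
    ⨍ p, inner ℝ (fluxField u (fun p => τ p.2.2) p) (Dθ p) ∂(layerMeasure lx ly) ≤
      m / 2 * meanEnstrophy Du + 1 / 2 * ⨍ p, ‖Dθ p‖ ^ 2 ∂(layerMeasure lx ly) := by
  have hA := layer_area_pos (lx := lx) (ly := ly)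
  obtain ⟨η', C, hη'm, hη'C, hηη'⟩ := hη.exists_measurable_bounded
  set K := m / 2 * meanEnstrophy Du + 1 / 2 * ⨍ p, ‖Dθ p‖ ^ 2 ∂(layerMeasure lx ly) with hK
  set F : Strip lx ly → ℝ := fun p => ∑ i, u i p * Dθ p i with hFdef
  have hF : Integrable F (layerMeasure lx ly) := integrable_finsetSum _ fun i _ =>
    (hu.memH10 i).memLp.integrable_mul (memLp_apply hθ.memLp_grad i)
  have hshift : ∀ a : AddCircle lx × AddCircle ly,
      ∫ p, η' (p + (a.1, a.2, 0)) * F p ∂(layerMeasure lx ly) ≤ lx * ly * K := by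
    intro a
    -- Rather than translating `η` forward, translate `u` and `θ` backward: this preserves their
    -- norms and keeps the supremum `m` of the original `η`.
    have hb : (-((a.1, a.2, 0) : Strip lx ly)).2.2 = 0 := by simp
    have h := average_inner_flux_le hη hm (hu.comp_add_right hb) (hθ.comp_add_right hb)
    have hE : meanEnstrophy (fun i p => Du i (p + -((a.1, a.2, 0) : Strip lx ly))) =
        meanEnstrophy Du := by
      rw [meanEnstrophy, meanEnstrophy, average_layer, average_layer,
        integral_comp_add_horizontal (fun p => ∑ i, ‖Du i p‖ ^ 2) hb]
    have hN : ⨍ p, ‖Dθ (p + -((a.1, a.2, 0) : Strip lx ly))‖ ^ 2 ∂(layerMeasure lx ly) =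
        ⨍ p, ‖Dθ p‖ ^ 2 ∂(layerMeasure lx ly) := by
      rw [average_layer, average_layer, integral_comp_add_horizontal (fun p => ‖Dθ p‖ ^ 2) hb]
    rw [hE, hN, ← hK, average_layer, inv_mul_le_iff₀ hA] at h
    refine le_trans (le_of_eq ?_) h
    rw [← integral_comp_add_horizontal _ hb]
    refine integral_congr_ae (hηη'.mono fun p hp => ?_)
    have e := inner_fluxField (fun i p => u i (p + -((a.1, a.2, 0) : Strip lx ly))) η
      (fun p => Dθ (p + -((a.1, a.2, 0) : Strip lx ly))) p
    rw [hp] at e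
    simp only [neg_add_cancel_right, hFdef]
    exact e.symm
  obtain ⟨hi, he⟩ := integral_horizontalMean_mul hη'm hη'C hF
  have hle := integral_mono hi (integrable_const (lx * ly * K)) hshift
  rw [he, integral_const, volume_real_torus, smul_eq_mul, mul_le_mul_iff_right₀ hA] at hle
  rw [average_layer, inv_mul_le_iff₀ hA]
  refine le_trans (le_of_eq (integral_congr_ae ?_)) hle
  have hae := hτ.trans (horizontalMean_congr hηη')
  filter_upwards [quasiMeasurePreserving_height.ae hae] with p hp
  rw [inner_fluxField, hp]

/-- The horizontal mean of an admissible field, as an absolutely continuous background field. -/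
theorem IsSymmAdmissible.exists_background (hη : IsSymmAdmissible η Dη) :
    ∃ τ : ℝ → ℝ, IsBackground τ ∧ τ =ᵐ[unitMeasure] horizontalMean η ∧
      ∫ z in (0 : ℝ)..1, deriv τ z ^ 2 ≤ ⨍ p, ‖Dη p‖ ^ 2 ∂(layerMeasure lx ly) := by
  have hv := hη.memH10_sub
  have hDη : MemLp Dη 2 (layerMeasure lx ly) := by
    refine (memLp_congr_ae (Eventually.of_forall fun p => ?_)).1
      (hv.memLp_grad.sub (memLp_const (!₂[(0 : ℝ), 0, 1] : E3)))
    simp only [Pi.sub_apply, add_sub_cancel_right]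
  have hDη2 := memLp_apply hDη 2
  obtain ⟨h0, hmean⟩ := hv.horizontalMean_eq
  have hg := (memLp_apply hv.memLp_grad 2).horizontalMean
  set g := horizontalMean (fun p => (Dη p + !₂[(0 : ℝ), 0, 1]) 2) with hgdef
  have hgi := hg.integrable one_le_two
  have hd : MemLp (fun z => g z - 1) 2 unitMeasure := hg.sub (memLp_const 1)
  have hdi := hd.integrable one_le_two
  have hint : ∀ z ∈ Icc (0 : ℝ) 1,
      ∫ t in (0 : ℝ)..z, (g t - 1) = (∫ t in (0 : ℝ)..z, g t) - z := by
    intro z hz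
    have hsub : uIcc (0 : ℝ) z ⊆ uIcc 0 1 := by
      rw [uIcc_of_le hz.1, uIcc_of_le zero_le_one]
      exact Icc_subset_Icc_right hz.2
    rw [intervalIntegral.integral_sub (hgi.intervalIntegrable_unit.mono_set hsub)
      intervalIntegrable_const]
    simp
  have hderiv := deriv_primitive_ae_eq hdi 1
  -- Here `g` is the mean of `∂_z(η - (1 - z))`, so `g - 1` is the mean of `∂_z η`. The value at `z
  -- = 1` is `0` because `g` has zero integral.
  refine ⟨fun z => 1 + ∫ t in (0 : ℝ)..z, (g t - 1),
    ⟨absolutelyContinuousOnInterval_primitive hdi 1, (memLp_congr_ae hderiv).2 hd, by simp, ?_⟩,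
    ?_, ?_⟩
  · rw [hint 1 (by simp), h0]
    norm_num
  · have hlin : Integrable (fun p : Strip lx ly => 1 - p.2.2) (layerMeasure lx ly) :=
      ((continuous_const.sub continuous_snd.snd).memLp_layer 1).integrable le_rfl
    have hadd := horizontalMean_add (hv.memLp.integrable one_le_two) hlin
    simp only [sub_add_cancel] at hadd
    filter_upwards [hadd, hmean, ae_unitMeasure_mem] with z h1 h2 hz
    rw [h1, h2, hint z hz, horizontalMean_height (fun z => 1 - z)]
    ring
  · have hadd := horizontalMean_add (hDη2.integrable one_le_two)
      (integrable_const (μ := layerMeasure lx ly) (1 : ℝ))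
    have hsq : ∫ z, deriv (fun z => 1 + ∫ t in (0 : ℝ)..z, (g t - 1)) z ^ 2 ∂unitMeasure =
        ∫ z, horizontalMean (fun p => Dη p 2) z ^ 2 ∂unitMeasure := by
      refine integral_congr_ae ?_
      filter_upwards [hderiv, hadd] with z h1 h2
      have h3 : g z = horizontalMean (fun p => Dη p 2 + 1) z := by simp [hgdef]
      rw [h1, h3, h2, horizontalMean_height (fun _ => (1 : ℝ)), add_sub_cancel_right]
    rw [← integral_unitMeasure, hsq]
    refine (integral_horizontalMean_sq_le hDη2).trans ?_
    rw [average_layer, average_layer]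
    refine mul_le_mul_of_nonneg_left (integral_mono hDη2.integrable_sq
      (hDη.integrable_norm_pow two_ne_zero) fun p => ?_) (inv_nonneg.2 layer_area_pos.le)
    simp only
    rw [← sq_abs]
    exact pow_le_pow_left₀ (abs_nonneg _) (PiLp.norm_apply_le (Dη p) 2) 2

/-- The competitor for `η` is its horizontal mean, with the transport supremum of `η` as multiplier.
-/
theorem bmValue_le_symmValue (Pe : ℝ) : bmValue lx ly Pe ≤ symmValue lx ly Pe := by
  refine le_sInf ?_
  rintro r ⟨η, Dη, hη, -, rfl⟩
  obtain ⟨m, hm⟩ := exists_transportSup_eq_coe hη.bounded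
  obtain ⟨τ, hτ, hτη, hle⟩ := hη.exists_background
  have hst : SpectrallyStable lx ly τ m := by
    intro u Du θ Dθ hu hθ
    have := average_inner_flux_horizontalMean_le hη.bounded hm hτη hu hθ
    rw [backgroundForm_eq hτ m hu hθ]
    linarith
  refine le_trans (b := (((∫ z in (0 : ℝ)..1, deriv τ z ^ 2) + m * Pe ^ 2 : ℝ) : EReal))
    (sInf_le ⟨τ, m, hτ, hst, rfl⟩) ?_
  rw [hm, ← EReal.coe_mul, ← EReal.coe_add, EReal.coe_le_coe_iff, mul_comm m]
  linarith

theorem symmValue_le_symmValueVertical (Pe : ℝ) :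
    symmValue lx ly Pe ≤ symmValueVertical lx ly Pe := by
  refine sInf_le_sInf ?_
  rintro r ⟨η, Dη, hη, -, hr⟩
  exact ⟨η, Dη, hη, mem_univ _, hr⟩

end Symmetrization

theorem mainTheorem11 (lx ly : ℝ) [Fact (0 < lx)] [Fact (0 < ly)] (Pe : ℝ) :
    bmValue lx ly Pe = symmValue lx ly Pe ∧
      symmValueVertical lx ly Pe = symmValue lx ly Pe := by
  have h1 := bmValue_le_symmValue (lx := lx) (ly := ly) Pe
  have h2 := symmValue_le_symmValueVertical (lx := lx) (ly := ly) Pe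
  have h3 := symmValueVertical_le_bmValue (lx := lx) (ly := ly) Pe
  exact ⟨le_antisymm h1 (h2.trans h3), le_antisymm (h3.trans h1) h2⟩
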